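/- For $\lambda\in\mathbb R$ put $e_\lambda(t)=e^{2\pi i\lambda t}$. A system of vectors in a Hilbert space is called a Riesz basis if it is the image of an orthonormal basis under a bounded invertible operator. Let $S\subseteq[0,1]$ be a union of $L$ intervals, let $N$ be a positive integer, and let $m\ge 0$ be the integer with $\frac mN\le |S|<\frac{m+1}N$, where $|S|$ is the Lebesgue measure of $S$. Then there exists a set $\Lambda\subseteq\mathbb Z$ such that the system $\{e_\lambda\}_{\lambda\in\Lambda}$ is a Riesz basis of $L^2(S)$ and $$\bigcup_{j=0}^{m-2L-1}(N\mathbb Z+j)\;\subseteq\;\Lambda\;\subseteq\;\bigcup_{j=0}^{m+2L}(N\mathbb Z+j),$$ where the union on the left is empty if $m-2L-1<0$. -/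

import Mathlib

open MeasureTheory

/-- A system of vectors in a Hilbert space is a *Riesz basis* if it is the image of an orthonormal
basis under a bounded invertible operator. -/
def IsRieszBasis {ι H : Type*} [NormedAddCommGroup H] [InnerProductSpace ℂ H]
    (f : ι → H) : Prop :=
  ∃ (b : HilbertBasis ι ℂ H) (T : H ≃L[ℂ] H), ∀ i, f i = T (b i)

/-- The exponential `e_l(t) = exp(2 π i l t)` of real frequency `l`. -/
noncomputable def expFun (l : ℝ) (t : ℝ) : ℂ :=
  Complex.exp (2 * Real.pi * Complex.I * l * t)

/-- The exponentials `e_l`, `l ∈ Λ`, belong to `L²(S)` and form a Riesz basis of `L²(S)`. The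
family `f` consists of the classes of the functions `e_l` in `L²(S)`, so it is unique. -/
def IsExpRieszBasis (S Λ : Set ℝ) : Prop :=
  ∃ f : Λ → Lp ℂ 2 (volume.restrict S),
    (∀ l : Λ, f l =ᵐ[volume.restrict S] expFun (l : ℝ)) ∧ IsRieszBasis f

/-- The arithmetic progression `Nℤ + j`, as a set of real numbers. -/
def progression (N : ℕ) (j : ℤ) : Set ℝ :=
  {x | ∃ k : ℤ, x = (N : ℝ) * k + j}

/-! Fold the unit interval `N` times: the points over `y` are `(y + j) / N` with `j < N`. Sorting
the frequencies of `g` by residue modulo `N` gives `g ((y + j) / N) = ∑ n, e_n ((y + j) / N) * g_n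
y`, which for fixed `y` is a polynomial in the node `e_1 ((y + j) / N)` with coefficients `g_n y`.
Let `S_n` be the set of `y` with more than `n` points of `S` over it. If integer frequencies `Λ_n`
serve `S_n` for every `n < N`, then the union of the sets `N Λ_n + n` serves `S` (`RestrBij.fold`).
Uniqueness holds because a polynomial of degree at most `n` with more than `n` roots vanishes,
existence by Lagrange interpolation; both run by descending recursion on `n`.

For a union of `L` intervals the number of sheets over two points differs by at most `L`, and its
mean is `N |S|`. Hence `S_n` is full for `n < m - L` and empty for `n ≥ m + L`, where `Λ_n` can be
`ℤ` and `∅`. This yields the two inclusions, even with `L` in place of `2L`.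

For the remaining `n`, `S_n` agrees almost everywhere with a periodic set that has finitely many
jumps modulo one, and `exists_restrBij_of_floorDet` treats such sets by induction on the number of
jumps. Folding by `N` moves the nodes `p i` to `N p i` and keeps the jumps. Two nodes at rational
distance merge for a suitable `N`. If all distances are irrational and there are at least four
nodes, some `N` makes the first Fourier coefficients of the sheet count too large for a function
with two consecutive values (`exists_large_jumpSum`, `jumpSum_le_of_intInd`), and then no level set
jumps at every node (`stepFun_eq_add_intInd`). If two nodes are left, some `N` makes the arc between
them shorter than a quarter, and there rounding the frequencies `n / θ` to integers is a small
perturbation of an orthonormal basis (`exists_equiv_perturbation`). -/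

/-! ### Exponentials -/

theorem expFun_eq (l t : ℝ) : expFun l t = Complex.exp (((2 * Real.pi * (l * t) : ℝ) : ℂ) * Complex.I) := by
  unfold expFun; congr 1; push_cast; ring

theorem norm_expFun (l t : ℝ) : ‖expFun l t‖ = 1 := by
  rw [expFun_eq, Complex.norm_exp_ofReal_mul_I]

theorem expFun_ne_zero (l t : ℝ) : expFun l t ≠ 0 := Complex.exp_ne_zero _

theorem expFun_add_left (a b t : ℝ) : expFun (a + b) t = expFun a t * expFun b t := by
  unfold expFun; rw [← Complex.exp_add]; congr 1; push_cast; ring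

theorem expFun_add_right (a s t : ℝ) : expFun a (s + t) = expFun a s * expFun a t := by
  unfold expFun; rw [← Complex.exp_add]; congr 1; push_cast; ring

theorem expFun_congr {a s b t : ℝ} (h : a * s = b * t) : expFun a s = expFun b t := by
  rw [expFun_eq, expFun_eq, h]

theorem expFun_zero_left (t : ℝ) : expFun 0 t = 1 := by simp [expFun]

theorem expFun_zero_right (l : ℝ) : expFun l 0 = 1 := by simp [expFun]

theorem conj_expFun (l t : ℝ) : (starRingEnd ℂ) (expFun l t) = expFun (-l) t := by
  rw [expFun_eq, expFun_eq, ← Complex.exp_conj]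
  congr 1
  simp only [map_mul, Complex.conj_ofReal, Complex.conj_I]
  push_cast; ring

theorem expFun_eq_one_iff (l t : ℝ) : expFun l t = 1 ↔ ∃ n : ℤ, l * t = n := by
  unfold expFun
  rw [Complex.exp_eq_one_iff]
  have hpi : (2 * Real.pi * Complex.I : ℂ) ≠ 0 := by simp [Real.pi_ne_zero]
  refine exists_congr fun n => ?_
  constructor
  · intro h
    have : ((l * t : ℝ) : ℂ) = ((n : ℝ) : ℂ) := by
      apply mul_left_cancel₀ hpi
      push_cast; linear_combination h
    exact_mod_cast this
  · intro h
    have : ((l * t : ℝ) : ℂ) = ((n : ℝ) : ℂ) := by rw [h]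
    push_cast at this
    linear_combination (2 * Real.pi * Complex.I : ℂ) * this

theorem expFun_int_int (k n : ℤ) : expFun k n = 1 :=
  (expFun_eq_one_iff _ _).2 ⟨k * n, by push_cast; rfl⟩

theorem expFun_pow (l t : ℝ) (n : ℕ) : expFun l t ^ n = expFun (n * l) t := by
  unfold expFun; rw [← Complex.exp_nat_mul]; congr 1; push_cast; ring

@[fun_prop]
theorem continuous_expFun (l : ℝ) : Continuous (expFun l) := by
  unfold expFun; fun_prop

/-! ### Fourier series on the unit interval -/

/-- Lebesgue measure on the unit interval. -/
noncomputable abbrev unitVol : Measure ℝ := volume.restrict (Set.Ioc (0 : ℝ) 1)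

instance isProbabilityMeasure_unitVol : IsProbabilityMeasure unitVol := ⟨by simp [unitVol]⟩

theorem measurePreserving_unitVol_circle :
    MeasurePreserving ((↑) : ℝ → AddCircle (1 : ℝ)) unitVol AddCircle.haarAddCircle := by
  have h := AddCircle.measurePreserving_mk (1 : ℝ) 0
  have h2 : (volume : Measure (AddCircle (1:ℝ))) = AddCircle.haarAddCircle := by
    rw [AddCircle.volume_eq_smul_haarAddCircle]; simp
  rw [h2, zero_add] at h
  exact h

/-- This section of the quotient map is what makes pulling back from the circle surjective on `L²`;
it also realises rotations modulo one. -/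
theorem exists_measurePreserving_circle_unitVol :
    ∃ r : AddCircle (1 : ℝ) → ℝ, MeasurePreserving r AddCircle.haarAddCircle unitVol ∧
      ∀ t ∈ Set.Ioc (0 : ℝ) 1, r t = t := by
  let r : AddCircle (1 : ℝ) → ℝ := fun z => (AddCircle.measurableEquivIoc (1 : ℝ) 0 z : ℝ)
  have hr : ∀ t ∈ Set.Ioc (0 : ℝ) 1, r t = t := by
    intro t ht
    have : AddCircle.equivIoc (1 : ℝ) 0 (t : AddCircle (1:ℝ)) = ⟨t, by simpa using ht⟩ :=
      AddCircle.equivIoc_coe_eq (by simpa using ht)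
    exact congrArg Subtype.val this
  have hm : Measurable r := measurable_subtype_coe.comp (AddCircle.measurableEquivIoc (1 : ℝ) 0).measurable
  refine ⟨r, ⟨hm, ?_⟩, hr⟩
  rw [← measurePreserving_unitVol_circle.map_eq, Measure.map_map hm measurePreserving_unitVol_circle.measurable]
  conv_rhs => rw [← Measure.map_id (μ := unitVol)]
  apply Measure.map_congr
  filter_upwards [ae_restrict_mem measurableSet_Ioc] with t ht
  exact hr t ht

/-- `L²` of the circle, as `L²` of the unit interval. -/
noncomputable def circleEquiv :
    Lp ℂ 2 (AddCircle.haarAddCircle (T := (1 : ℝ))) ≃ₗᵢ[ℂ] Lp ℂ 2 unitVol :=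
  LinearIsometryEquiv.ofSurjective
    (Lp.compMeasurePreservingₗᵢ ℂ _ measurePreserving_unitVol_circle) (by
      intro g
      obtain ⟨r, hr, hr2⟩ := exists_measurePreserving_circle_unitVol
      refine ⟨Lp.compMeasurePreserving r hr g, ?_⟩
      change Lp.compMeasurePreserving _ measurePreserving_unitVol_circle _ = g
      apply Lp.ext
      refine (Lp.coeFn_compMeasurePreserving _ _).trans ?_
      have h1 := measurePreserving_unitVol_circle.quasiMeasurePreserving.ae_eq_comp
        (Lp.coeFn_compMeasurePreserving g hr)
      refine h1.trans ?_
      filter_upwards [ae_restrict_mem measurableSet_Ioc] with t ht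
      simp [hr2 t ht])

/-- The orthonormal basis of exponentials with integer frequency. -/
noncomputable def expBasis : HilbertBasis ℤ ℂ (Lp ℂ 2 unitVol) :=
  HilbertBasis.ofRepr (circleEquiv.symm.trans fourierBasis.repr)

theorem coeFn_expBasis (k : ℤ) : expBasis k =ᵐ[unitVol] expFun k := by
  have h : expBasis k = circleEquiv (fourierBasis k) := by
    simp [expBasis, ← HilbertBasis.repr_symm_single]
  rw [h, coe_fourierBasis]
  refine (Lp.coeFn_compMeasurePreserving _ measurePreserving_unitVol_circle).trans ?_
  refine (measurePreserving_unitVol_circle.quasiMeasurePreserving.ae_eq_comp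
    (coeFn_fourierLp 2 k)).trans ?_
  filter_upwards with t
  simp only [Function.comp_apply, fourier_coe_apply, expFun]
  congr 1; push_cast; ring

/-- The Fourier coefficient of a function on the unit interval. -/
noncomputable def fcoeff (g : ℝ → ℂ) (k : ℤ) : ℂ := ∫ t, expFun (-k) t * g t ∂unitVol

theorem fcoeff_congr {f g : ℝ → ℂ} (h : f =ᵐ[unitVol] g) (k : ℤ) : fcoeff f k = fcoeff g k :=
  integral_congr_ae (h.mono fun t ht => by simp only [ht])

theorem expBasis_repr (g : Lp ℂ 2 unitVol) (k : ℤ) : expBasis.repr g k = fcoeff g k := by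
  rw [HilbertBasis.repr_apply_apply, L2.inner_def]
  apply integral_congr_ae
  filter_upwards [coeFn_expBasis k] with t ht
  rw [ht, RCLike.inner_apply, conj_expFun, mul_comm]

theorem expBasis_repr_toLp {g : ℝ → ℂ} (hg : MemLp g 2 unitVol) (k : ℤ) :
    expBasis.repr (hg.toLp g) k = fcoeff g k := by
  rw [expBasis_repr]; exact fcoeff_congr hg.coeFn_toLp k

theorem Lp_eq_of_fcoeff {f g : Lp ℂ 2 unitVol} (h : ∀ k, fcoeff f k = fcoeff g k) : f = g := by
  apply expBasis.repr.injective
  ext k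
  rw [expBasis_repr, expBasis_repr, h]

theorem ae_eq_of_fcoeff {f g : ℝ → ℂ} (hf : MemLp f 2 unitVol) (hg : MemLp g 2 unitVol)
    (h : ∀ k, fcoeff f k = fcoeff g k) : f =ᵐ[unitVol] g := by
  have : hf.toLp f = hg.toLp g := by
    apply Lp_eq_of_fcoeff
    intro k
    rw [fcoeff_congr hf.coeFn_toLp, fcoeff_congr hg.coeFn_toLp, h]
  exact (MemLp.toLp_eq_toLp_iff hf hg).1 this

theorem ae_eq_zero_of_fcoeff {f : ℝ → ℂ} (hf : MemLp f 2 unitVol) (h : ∀ k, fcoeff f k = 0) :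
    f =ᵐ[unitVol] 0 :=
  ae_eq_of_fcoeff hf MemLp.zero fun k => by rw [h]; simp [fcoeff]

/-! ### Functions with prescribed spectrum -/

section synthesis
variable {ι : Type*} (σ : ι → ℤ) (hσ : Function.Injective σ)

/-- The function with prescribed Fourier coefficients at the frequencies `σ i`. -/
noncomputable def synth : lp (fun _ : ι => ℂ) 2 →ₗᵢ[ℂ] Lp ℂ 2 unitVol :=
  (expBasis.orthonormal.comp σ hσ).orthogonalFamily.linearIsometry

theorem synth_single [DecidableEq ι] (i : ι) : synth σ hσ (lp.single 2 i 1) = expBasis (σ i) := by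
  simp [synth]

theorem repr_synth (a : lp (fun _ : ι => ℂ) 2) (i : ι) :
    expBasis.repr (synth σ hσ a) (σ i) = a i := by
  classical
  rw [HilbertBasis.repr_apply_apply, ← synth_single σ hσ i, LinearIsometry.inner_map_map,
    lp.inner_single_left]
  simp

theorem repr_synth_of_notMem (a : lp (fun _ : ι => ℂ) 2) {l : ℤ} (hl : l ∉ Set.range σ) :
    expBasis.repr (synth σ hσ a) l = 0 := by
  classical
  have h := (expBasis.orthonormal.comp σ hσ).orthogonalFamily.hasSum_linearIsometry a
  have h2 : HasSum (fun i => inner ℂ (expBasis l) ((LinearIsometry.toSpanSingleton ℂ _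
    ((expBasis.orthonormal.comp σ hσ).1 i)) (a i))) (inner ℂ (expBasis l) (synth σ hσ a)) :=
      h.mapL (innerSL ℂ (expBasis l))
  rw [HilbertBasis.repr_apply_apply]
  refine h2.unique ?_
  convert! hasSum_zero with i
  have : l ≠ σ i := fun h => hl ⟨i, h.symm⟩
  simp [inner_smul_right, expBasis.orthonormal.inner_eq_zero this]

theorem exists_synth_eq (x : Lp ℂ 2 unitVol) (hx : ∀ l ∉ Set.range σ, expBasis.repr x l = 0) :
    ∃ a, synth σ hσ a = x := by
  have hm : Memℓp (fun i => expBasis.repr x (σ i)) 2 := by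
    rw [memℓp_gen_iff (by norm_num)]
    exact ((lp.memℓp (expBasis.repr x)).summable (by norm_num)).comp_injective hσ
  refine ⟨⟨_, hm⟩, ?_⟩
  apply expBasis.repr.injective
  ext l
  by_cases hl : l ∈ Set.range σ
  · obtain ⟨i, rfl⟩ := hl
    rw [repr_synth]
  · rw [repr_synth_of_notMem _ _ _ hl, hx l hl]

end synthesis

/-! ### Restriction to a set as a bijection -/

/-- Square integrable functions on the unit interval with spectrum in `Λ`. -/
def HasSpec (g : ℝ → ℂ) (Λ : Set ℤ) : Prop :=
  MemLp g 2 unitVol ∧ ∀ k ∉ Λ, fcoeff g k = 0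

/-- Restriction to `S` is a bijection from the functions with spectrum in `Λ` onto `L²(S)`. -/
def RestrBij (S : Set ℝ) (Λ : Set ℤ) : Prop :=
  (∀ g, HasSpec g Λ → (∀ᵐ t ∂unitVol, t ∈ S → g t = 0) → g =ᵐ[unitVol] 0) ∧
  ∀ u, MemLp u 2 unitVol → ∃ g, HasSpec g Λ ∧ ∀ᵐ t ∂unitVol, t ∈ S → g t = u t

theorem RestrBij.congr {S S' : Set ℝ} {Λ : Set ℤ} (h : RestrBij S Λ)
    (hS : ∀ᵐ t ∂unitVol, (t ∈ S ↔ t ∈ S')) : RestrBij S' Λ := by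
  refine ⟨fun g hg h0 => h.1 g hg ?_, fun u hu => ?_⟩
  · filter_upwards [hS, h0] with t h1 h2 h3 using h2 (h1.1 h3)
  · obtain ⟨g, hg, hgu⟩ := h.2 u hu
    refine ⟨g, hg, ?_⟩
    filter_upwards [hS, hgu] with t h1 h2 h3 using h2 (h1.2 h3)

theorem restrBij_univ {S : Set ℝ} (hS : ∀ᵐ t ∂unitVol, t ∈ S) : RestrBij S Set.univ := by
  refine ⟨fun g _ h0 => ?_, fun u hu => ⟨u, ⟨hu, by simp⟩, by simp⟩⟩
  filter_upwards [hS, h0] with t h1 h2 using h2 h1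

theorem restrBij_empty {S : Set ℝ} (hS : ∀ᵐ t ∂unitVol, t ∉ S) : RestrBij S ∅ := by
  refine ⟨fun g hg _ => ae_eq_zero_of_fcoeff hg.1 fun k => hg.2 k (by simp), fun u _ => ?_⟩
  refine ⟨0, ⟨MemLp.zero, by simp [fcoeff]⟩, ?_⟩
  filter_upwards [hS] with t h1 h2 using absurd h2 h1

/-! ### Composition operators -/

section composition
variable {μ : Measure ℝ} {φ : ℝ → ℝ} {c : ENNReal}

theorem eLpNorm_comp_le_of_map_le (hφ : Measurable φ) (h : μ.map φ ≤ c • unitVol) {g : ℝ → ℂ}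
    (hg : MemLp g 2 unitVol) (hc : c ≠ ⊤) :
    eLpNorm (g ∘ φ) 2 μ ≤ c ^ (1 / (2 : ENNReal)).toReal * eLpNorm g 2 unitVol := by
  rw [← eLpNorm_map_measure (hg.of_measure_le_smul hc h).1 hφ.aemeasurable]
  exact eLpNorm_le_of_measure_le_smul h

theorem MeasureTheory.MemLp.comp_of_map_le (hφ : Measurable φ) (hc : c ≠ ⊤) (h : μ.map φ ≤ c • unitVol)
    {g : ℝ → ℂ} (hg : MemLp g 2 unitVol) : MemLp (g ∘ φ) 2 μ :=
  (hg.of_measure_le_smul hc h).comp_of_map hφ.aemeasurable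

theorem quasiMeasurePreserving_of_map_le (hφ : Measurable φ) (h : μ.map φ ≤ c • unitVol) :
    Measure.QuasiMeasurePreserving φ μ unitVol :=
  ⟨hφ, Measure.absolutelyContinuous_of_le_smul h⟩

/-- Composition with `φ` as an operator on `L²`. -/
noncomputable def compLp (hφ : Measurable φ) (hc : c ≠ ⊤) (h : μ.map φ ≤ c • unitVol) :
    Lp ℂ 2 unitVol →L[ℂ] Lp ℂ 2 μ :=
  LinearMap.mkContinuous
    { toFun := fun g => (MemLp.comp_of_map_le hφ hc h (Lp.memLp g)).toLp (g ∘ φ)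
      map_add' := fun f g => by
        rw [← MemLp.toLp_add, MemLp.toLp_eq_toLp_iff]
        exact (quasiMeasurePreserving_of_map_le hφ h).ae_eq_comp (Lp.coeFn_add f g)
      map_smul' := fun a g => by
        rw [RingHom.id_apply, ← MemLp.toLp_const_smul, MemLp.toLp_eq_toLp_iff]
        exact (quasiMeasurePreserving_of_map_le hφ h).ae_eq_comp (Lp.coeFn_smul a g) }
    (c ^ (1 / (2 : ENNReal)).toReal).toReal (by
      intro g
      simp only [LinearMap.coe_mk, AddHom.coe_mk]
      rw [Lp.norm_toLp, Lp.norm_def, ← ENNReal.toReal_mul]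
      apply ENNReal.toReal_mono
      · exact ENNReal.mul_ne_top (ENNReal.rpow_ne_top_of_nonneg (by simp) hc) (Lp.eLpNorm_ne_top g)
      · exact eLpNorm_comp_le_of_map_le hφ h (Lp.memLp g) hc)

theorem coeFn_compLp (hφ : Measurable φ) (hc : c ≠ ⊤) (h : μ.map φ ≤ c • unitVol)
    (g : Lp ℂ 2 unitVol) : compLp hφ hc h g =ᵐ[μ] g ∘ φ :=
  (MemLp.comp_of_map_le hφ hc h (Lp.memLp g)).coeFn_toLp

theorem compLp_expBasis (hφ : Measurable φ) (hc : c ≠ ⊤) (h : μ.map φ ≤ c • unitVol) (k : ℤ) :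
    compLp hφ hc h (expBasis k) =ᵐ[μ] fun t => expFun k (φ t) :=
  (coeFn_compLp hφ hc h _).trans
    ((quasiMeasurePreserving_of_map_le hφ h).ae_eq_comp (coeFn_expBasis k))

end composition

/-! ### From bijective restriction to Riesz bases -/

/-- Isomorphic Hilbert spaces are isometric, by polar decomposition. -/
theorem exists_linearIsometryEquiv_of_equiv {A H : Type*} [NormedAddCommGroup A]
    [InnerProductSpace ℂ A] [CompleteSpace A] [NormedAddCommGroup H]
    [InnerProductSpace ℂ H] [CompleteSpace H] (U : A ≃L[ℂ] H) : Nonempty (A ≃ₗᵢ[ℂ] H) := by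
  let U' : A →L[ℂ] H := U
  let P : A →L[ℂ] A := (ContinuousLinearMap.adjoint U').comp U'
  have hP : 0 ≤ P := by
    rw [ContinuousLinearMap.nonneg_iff_isPositive]
    exact ContinuousLinearMap.isPositive_adjoint_comp_self U'
  have hUadj : IsUnit P := by
    let V : H →L[ℂ] A := U.symm
    have h1 : V.comp U' = ContinuousLinearMap.id ℂ A := by ext1 x; exact U.symm_apply_apply x
    have h2 : U'.comp V = ContinuousLinearMap.id ℂ H := by ext1 x; exact U.apply_symm_apply x
    have h3 : (ContinuousLinearMap.adjoint U').comp (ContinuousLinearMap.adjoint V) =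
        ContinuousLinearMap.id ℂ A := by
      rw [← ContinuousLinearMap.adjoint_comp, h1]
      exact ContinuousLinearMap.adjoint_id
    have h4 : (ContinuousLinearMap.adjoint V).comp (ContinuousLinearMap.adjoint U') =
        ContinuousLinearMap.id ℂ H := by
      rw [← ContinuousLinearMap.adjoint_comp, h2]
      exact ContinuousLinearMap.adjoint_id
    refine ⟨⟨P, V.comp (ContinuousLinearMap.adjoint V), ?_, ?_⟩, rfl⟩
    · ext1 x
      have e1 : U' (V (ContinuousLinearMap.adjoint V x)) = ContinuousLinearMap.adjoint V x :=
        U.apply_symm_apply _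
      change ContinuousLinearMap.adjoint U' (U' (V (ContinuousLinearMap.adjoint V x))) = x
      rw [e1]
      exact congrArg (fun F => F x) h3
    · ext1 x
      have e1 : ContinuousLinearMap.adjoint V (ContinuousLinearMap.adjoint U' (U' x)) = U' x :=
        congrArg (fun F => F (U' x)) h4
      change V (ContinuousLinearMap.adjoint V (ContinuousLinearMap.adjoint U' (U' x))) = x
      rw [e1]
      exact U.symm_apply_apply x
  -- `Q` is the modulus of `U`, the positive square root of `U* U`. It satisfies `‖Q x‖ = ‖U x‖`, so
  -- `U Q⁻¹` is isometric.
  obtain ⟨Q, hQ0, hQQ, Qu, hQu⟩ : ∃ Q : A →L[ℂ] A, 0 ≤ Q ∧ Q * Q = P ∧ IsUnit Q :=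
    ⟨CFC.sqrt P, CFC.sqrt_nonneg P, CFC.sqrt_mul_sqrt_self P hP, (CFC.isUnit_sqrt_iff P hP).2 hUadj⟩
  have hQsa : ContinuousLinearMap.adjoint Q = Q :=
    ((ContinuousLinearMap.nonneg_iff_isPositive _).1 hQ0).isSelfAdjoint.adjoint_eq
  let Qe : A ≃L[ℂ] A := ContinuousLinearEquiv.unitsEquiv ℂ A Qu
  have hQe : ∀ x, Qe x = Q x := fun x => by rw [← hQu]; rfl
  have hnorm : ∀ x, ‖U x‖ = ‖Q x‖ := by
    intro x
    have h1 : inner ℂ (U' x) (U' x) = inner ℂ (Q x) (Q x) := by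
      rw [← ContinuousLinearMap.adjoint_inner_right U', ← ContinuousLinearMap.adjoint_inner_right Q,
        hQsa]
      change inner ℂ x (P x) = inner ℂ x ((Q * Q) x)
      rw [hQQ]
    rw [inner_self_eq_norm_sq_to_K, inner_self_eq_norm_sq_to_K] at h1
    have h2 : ‖U' x‖ ^ 2 = ‖Q x‖ ^ 2 := by exact_mod_cast h1
    exact (sq_eq_sq₀ (norm_nonneg _) (norm_nonneg _)).1 h2
  let W : A ≃L[ℂ] H := Qe.symm.trans U
  have hW : ∀ x, ‖W x‖ = ‖x‖ := by
    intro x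
    change ‖U (Qe.symm x)‖ = ‖x‖
    rw [hnorm, ← hQe, Qe.apply_symm_apply]
  exact ⟨⟨W.toLinearEquiv, hW⟩⟩

/-- The images of the standard unit vectors under an isomorphism from `ℓ²` form a Riesz basis. -/
theorem isRieszBasis_of_equiv {ι H : Type*} [DecidableEq ι] [NormedAddCommGroup H]
    [InnerProductSpace ℂ H] [CompleteSpace H] (U : lp (fun _ : ι => ℂ) 2 ≃L[ℂ] H) :
    IsRieszBasis fun i => U (lp.single 2 i 1) := by
  obtain ⟨W⟩ := exists_linearIsometryEquiv_of_equiv U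
  refine ⟨HilbertBasis.ofRepr W.symm, W.symm.toContinuousLinearEquiv.trans U, fun i => ?_⟩
  have hb : (HilbertBasis.ofRepr W.symm) i = W (lp.single 2 i 1) := by
    rw [← HilbertBasis.repr_symm_single]; rfl
  rw [hb]
  change _ = U (W.symm (W _))
  rw [W.symm_apply_apply]

/-- Synthesis from `ℓ²` followed by restriction to `S` is bounded and bijective, so the open mapping
theorem supplies the bounded inverse. This is why `RestrBij` carries no norm estimates. -/
theorem RestrBij.isExpRieszBasis {S : Set ℝ} {Λ : Set ℤ} (h : RestrBij S Λ)
    (hS : volume.restrict S = unitVol.restrict S) (hm : MeasurableSet S) :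
    IsExpRieszBasis S ((fun k : ℤ => (k : ℝ)) '' Λ) := by
  classical
  unfold IsExpRieszBasis
  rw [hS]
  -- The floor recovers the integer from its image in `ℝ`.
  let σ : ((fun k : ℤ => (k : ℝ)) '' Λ) → ℤ := fun x => ⌊(x : ℝ)⌋
  have hσc : ∀ x, ((σ x : ℤ) : ℝ) = x := by
    rintro ⟨_, k, hk, rfl⟩; simp [σ]
  have hσ : Function.Injective σ := fun x y hxy => by
    apply Subtype.ext; rw [← hσc x, ← hσc y, hxy]
  have hr : Set.range σ = Λ := by
    ext k; constructor
    · rintro ⟨⟨_, l, hl, rfl⟩, rfl⟩; simpa [σ] using hl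
    · intro hk; exact ⟨⟨k, k, hk, rfl⟩, by simp [σ]⟩
  have hle : (unitVol.restrict S).map id ≤ (1 : ENNReal) • unitVol := by
    rw [Measure.map_id, one_smul]; exact Measure.restrict_le_self
  let R := compLp measurable_id ENNReal.one_ne_top hle
  let U : lp (fun _ : ((fun k : ℤ => (k : ℝ)) '' Λ) => ℂ) 2 →L[ℂ] Lp ℂ 2 (unitVol.restrict S) :=
    R.comp (synth σ hσ).toContinuousLinearMap
  have hU : ∀ a, U a =ᵐ[unitVol.restrict S] synth σ hσ a := fun a =>
    coeFn_compLp measurable_id ENNReal.one_ne_top hle (synth σ hσ a)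
  have hspec : ∀ a, HasSpec (synth σ hσ a) Λ := fun a => ⟨Lp.memLp _, fun k hk => by
    rw [← expBasis_repr]; exact repr_synth_of_notMem σ hσ a (by rwa [hr])⟩
  have hinj : Function.Injective U := by
    rw [injective_iff_map_eq_zero]
    intro a ha
    have h0 := h.1 _ (hspec a) (by
      rw [← ae_restrict_iff' hm]
      have := hU a
      rw [ha] at this
      filter_upwards [this, Lp.coeFn_zero ℂ 2 (unitVol.restrict S)] with t h1 h2
      rw [← h1, h2]; rfl)
    have : synth σ hσ a = 0 := Lp.eq_zero_iff_ae_eq_zero.2 h0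
    exact (synth σ hσ).injective (this.trans (map_zero _).symm)
  have hsurj : Function.Surjective U := by
    intro v
    let u : ℝ → ℂ := S.indicator v
    have hu : MemLp u 2 unitVol := (memLp_indicator_iff_restrict hm).2 (Lp.memLp v)
    obtain ⟨g, hg, hgu⟩ := h.2 u hu
    obtain ⟨a, ha⟩ := exists_synth_eq σ hσ (hg.1.toLp g) (by
      intro l hl
      rw [expBasis_repr_toLp]; exact hg.2 l (by rwa [← hr]))
    refine ⟨a, Lp.ext ((hU a).trans ?_)⟩
    rw [ha]
    rw [← ae_restrict_iff' hm] at hgu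
    filter_upwards [ae_restrict_of_ae hg.1.coeFn_toLp, hgu, ae_restrict_mem hm] with t h1 h2 h3
    rw [h1, h2]; simp [u, h3]
  let Ue := ContinuousLinearEquiv.ofBijective U (LinearMap.ker_eq_bot.2 hinj)
    (LinearMap.range_eq_top.2 hsurj)
  refine ⟨_, fun l => ?_, isRieszBasis_of_equiv Ue⟩
  change U (lp.single 2 l 1) =ᵐ[_] _
  refine (hU _).trans ?_
  rw [synth_single]
  refine ae_restrict_of_ae ?_
  rw [← hσc l]
  exact coeFn_expBasis (σ l)

/-! ### Folding the unit interval -/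

theorem map_affine_unitVol_le {a b : ℝ} (ha : 0 < a)
    (h : ∀ y ∈ Set.Ioc (0 : ℝ) 1, a * y + b ∈ Set.Ioc (0 : ℝ) 1) :
    unitVol.map (fun y => a * y + b) ≤ ENNReal.ofReal a⁻¹ • unitVol := by
  have hm : Measurable fun y : ℝ => a * y + b := by fun_prop
  refine Measure.le_iff.2 fun s hs => ?_
  rw [Measure.map_apply hm hs, Measure.restrict_apply (hm hs), Measure.smul_apply,
    Measure.restrict_apply hs, smul_eq_mul]
  have h1 : ((fun y => a * y + b) ⁻¹' s ∩ Set.Ioc 0 1) ⊆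
      (fun y => a * y) ⁻¹' ((fun y => y + b) ⁻¹' (s ∩ Set.Ioc 0 1)) :=
    fun y hy => ⟨hy.1, h y hy.2⟩
  refine (measure_mono h1).trans ?_
  rw [Real.volume_preimage_mul_left ha.ne', measure_preimage_add_right, abs_of_pos (inv_pos.2 ha)]

theorem quasiMeasurePreserving_affine {a : ℝ} (b : ℝ) (ha : a ≠ 0) :
    Measure.QuasiMeasurePreserving (fun y : ℝ => a * y + b) volume volume := by
  refine ⟨by fun_prop, Measure.AbsolutelyContinuous.mk fun s hs h0 => ?_⟩
  rw [Measure.map_apply (by fun_prop) hs]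
  change volume ((fun y => a * y) ⁻¹' ((fun y => y + b) ⁻¹' s)) = 0
  rw [Real.volume_preimage_mul_left ha, measure_preimage_add_right, h0, mul_zero]

section folding
variable {N : ℕ}

theorem foldPt_mem {j : ℕ} (hj : j < N) {y : ℝ} (hy : y ∈ Set.Ioc (0 : ℝ) 1) :
    (y + j) / N ∈ Set.Ioc (0 : ℝ) 1 := by
  have hN : (0 : ℝ) < N := by exact_mod_cast (Nat.zero_le j).trans_lt hj
  have h1 : (j : ℝ) + 1 ≤ N := by exact_mod_cast hj
  refine ⟨div_pos (by linarith [hy.1, (Nat.cast_nonneg j : (0:ℝ) ≤ j)]) hN, ?_⟩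
  rw [div_le_one hN]; linarith [hy.2]

theorem map_foldPt_le {j : ℕ} (hj : j < N) :
    unitVol.map (fun y : ℝ => (y + j) / N) ≤ ENNReal.ofReal ((N : ℝ)⁻¹)⁻¹ • unitVol := by
  have hN : (0 : ℝ) < N := by exact_mod_cast (Nat.zero_le j).trans_lt hj
  have e : (fun y : ℝ => (y + j) / N) = fun y => (N : ℝ)⁻¹ * y + j / N := by
    ext y; field_simp
  rw [e]
  refine map_affine_unitVol_le (inv_pos.2 hN) fun y hy => ?_
  have := foldPt_mem hj hy
  rwa [congrFun e y] at this

theorem MeasureTheory.MemLp.comp_foldPt {j : ℕ} (hj : j < N) {g : ℝ → ℂ} (hg : MemLp g 2 unitVol) :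
    MemLp (fun y : ℝ => g ((y + j) / N)) 2 unitVol :=
  MemLp.comp_of_map_le (by fun_prop) ENNReal.ofReal_ne_top (map_foldPt_le hj) hg

theorem ae_foldPt {P : ℝ → Prop} (h : ∀ᵐ t ∂unitVol, P t) :
    ∀ᵐ y ∂unitVol, ∀ j < N, P ((y + j) / N) := by
  rw [ae_all_iff]; intro j
  by_cases hj : j < N
  · filter_upwards [(quasiMeasurePreserving_of_map_le (by fun_prop) (map_foldPt_le hj)).ae h]
      with y hy _ using hy
  · exact Filter.Eventually.of_forall fun y h => absurd h hj

theorem exists_foldPt_eq (hN : 0 < N) {t : ℝ} (ht : t ∈ Set.Ioc (0 : ℝ) 1) :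
    ∃ j < N, ∃ y ∈ Set.Ioc (0 : ℝ) 1, y = N * t + (-(j : ℝ)) ∧ (y + j) / N = t := by
  have hN' : (0 : ℝ) < N := by exact_mod_cast hN
  have hpos : 0 < (N : ℝ) * t := mul_pos hN' ht.1
  have hc : 0 < ⌈(N : ℝ) * t⌉₊ := Nat.ceil_pos.2 hpos
  obtain ⟨j, hj⟩ : ∃ j, ⌈(N : ℝ) * t⌉₊ = j + 1 := ⟨_, (Nat.succ_pred_eq_of_pos hc).symm⟩
  have h1 : (N : ℝ) * t ≤ j + 1 := by
    have := Nat.le_ceil ((N : ℝ) * t); rw [hj] at this; exact_mod_cast this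
  have h2 : (j : ℝ) < N * t := by
    have := Nat.ceil_lt_add_one hpos.le; rw [hj] at this; push_cast at this; linarith
  have h3 : j < N := by
    have : (j : ℝ) < N := h2.trans_le (by nlinarith [ht.2])
    exact_mod_cast this
  refine ⟨j, h3, N * t + (-(j : ℝ)), ⟨by linarith, by linarith⟩, rfl, ?_⟩
  field_simp; ring

/-- Each `t` is `(y + j) / N` with `y = N t - j` for some `j < N`, and each of these countably many
affine maps pulls null sets back to null sets. -/
theorem ae_of_ae_foldPt (hN : 0 < N) {P : ℝ → Prop}
    (h : ∀ᵐ y ∂unitVol, ∀ j < N, P ((y + j) / N)) : ∀ᵐ t ∂unitVol, P t := by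
  have hN' : (N : ℝ) ≠ 0 := by exact_mod_cast hN.ne'
  rw [ae_restrict_iff' measurableSet_Ioc] at h ⊢
  have h2 : ∀ᵐ t : ℝ, ∀ j : ℕ, (N : ℝ) * t + (-(j : ℝ)) ∈ Set.Ioc (0 : ℝ) 1 →
      ∀ j' < N, P (((N : ℝ) * t + (-(j : ℝ)) + j') / N) := by
    rw [ae_all_iff]; intro j
    exact (quasiMeasurePreserving_affine (-(j : ℝ)) hN').ae h
  filter_upwards [h2] with t ht htI
  obtain ⟨j, hj, y, hy, rfl, hy2⟩ := exists_foldPt_eq hN htI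
  have := ht j hy j hj
  rwa [hy2] at this

theorem integral_unitVol_foldPt (hN : 0 < N) {F : ℝ → ℂ} (hF : Integrable F unitVol) :
    ∫ t, F t ∂unitVol = ∑ j ∈ Finset.range N, (N : ℂ)⁻¹ * ∫ y, F ((y + j) / N) ∂unitVol := by
  have hN' : (N : ℝ) ≠ 0 := by exact_mod_cast hN.ne'
  have hNp : (0 : ℝ) < N := by exact_mod_cast hN
  simp only [unitVol, ← intervalIntegral.integral_of_le zero_le_one]
  have h1 : ∀ j ∈ Finset.range N, (N : ℂ)⁻¹ * ∫ y in (0 : ℝ)..1, F ((y + j) / N) =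
      ∫ t in ((j : ℕ) : ℝ) / N..((j + 1 : ℕ) : ℝ) / N, F t := by
    intro j _
    have := intervalIntegral.integral_comp_div_add (a := 0) (b := 1) F hN' ((j : ℝ) / N)
    have e : (fun y : ℝ => F (y / N + j / N)) = fun y => F ((y + j) / N) := by
      ext y; rw [add_div]
    rw [e] at this
    rw [this]
    simp only [zero_div, zero_add, Complex.real_smul, Complex.ofReal_natCast]
    rw [← mul_assoc, inv_mul_cancel₀ (by exact_mod_cast hN.ne'), one_mul]
    congr 1; push_cast; ring
  rw [Finset.sum_congr rfl h1]
  have h2 := intervalIntegral.sum_integral_adjacent_intervals (f := F) (μ := volume) (n := N)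
    (a := fun j : ℕ => (j : ℝ) / N) (by
      intro k hk
      rw [intervalIntegrable_iff_integrableOn_Ioc_of_le (by gcongr; simp)]
      refine IntegrableOn.mono_set hF (Set.Ioc_subset_Ioc (by positivity) ?_)
      rw [div_le_one hNp]; exact_mod_cast hk)
  rw [h2]
  simp [hN']

theorem MeasureTheory.MemLp.expFun_mul {g : ℝ → ℂ} (hg : MemLp g 2 unitVol) (l : ℝ) {φ : ℝ → ℝ}
    (hφ : Continuous φ) : MemLp (fun t => expFun l (φ t) * g t) 2 unitVol := by
  refine hg.of_le ?_ (Filter.Eventually.of_forall fun t => by simp [norm_expFun])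
  exact (((continuous_expFun l).comp hφ).aestronglyMeasurable).mul hg.1

/-- The component of `g` with frequencies in `Nℤ + n`, as a function on the folded interval. -/
noncomputable def foldComp (N : ℕ) (g : ℝ → ℂ) (n : ℕ) (y : ℝ) : ℂ :=
  ∑ j ∈ Finset.range N, (N : ℂ)⁻¹ * (expFun (-n) ((y + j) / N) * g ((y + j) / N))

theorem memLp_foldComp {g : ℝ → ℂ} (hg : MemLp g 2 unitVol) (n : ℕ) :
    MemLp (foldComp N g n) 2 unitVol := by
  refine memLp_finsetSum (Finset.range N) fun j hj => ?_
  exact ((MemLp.comp_foldPt (Finset.mem_range.1 hj) hg).expFun_mul (-n)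
    (φ := fun y => (y + j) / N) (by fun_prop)).const_mul _

/-- Folding the integral for the coefficient `N k + n` works because `e_{-Nk} ((y + j) / N) = e_{-k}
y` does not depend on `j`. -/
theorem fcoeff_foldComp (hN : 0 < N) {g : ℝ → ℂ} (hg : MemLp g 2 unitVol) (n : ℕ) (k : ℤ) :
    fcoeff (foldComp N g n) k = fcoeff g (N * k + n) := by
  have hN' : (N : ℝ) ≠ 0 := by exact_mod_cast hN.ne'
  have h1 : ∀ g : ℝ → ℂ, MemLp g 2 unitVol → Integrable g unitVol :=
    fun g hg => hg.integrable (by norm_num)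
  rw [fcoeff, fcoeff, integral_unitVol_foldPt hN
    (h1 _ (hg.expFun_mul (-((N * k + n : ℤ) : ℝ)) (φ := fun t => t) (by fun_prop)))]
  simp only [foldComp, Finset.mul_sum]
  rw [integral_finsetSum]
  · refine Finset.sum_congr rfl fun j _ => ?_
    rw [← integral_const_mul]
    congr 1; ext y
    have : expFun (-((N * k + n : ℤ) : ℝ)) ((y + j) / N) =
        expFun (-k) y * expFun (-n) ((y + j) / N) := by
      have e : (-((N * k + n : ℤ) : ℝ)) = -(N * k : ℝ) + -n := by push_cast; ring
      rw [e, expFun_add_left]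
      congr 1
      have e2 : expFun (-(N * k : ℝ)) ((y + j) / N) = expFun (-k) (y + j) :=
        expFun_congr (by field_simp)
      have e3 : expFun (-k) (j : ℝ) = 1 := by simpa using expFun_int_int (-k) j
      rw [e2, expFun_add_right, e3, mul_one]
    rw [this]; ring
  · intro j hj
    refine h1 _ (MemLp.expFun_mul (φ := fun t => t) ?_ _ (by fun_prop))
    exact ((MemLp.comp_foldPt (Finset.mem_range.1 hj) hg).expFun_mul (-n)
      (φ := fun y => (y + j) / N) (by fun_prop)).const_mul _

theorem expFun_one_div_injOn (N : ℕ) {j l : ℕ} (hj : j < N) (hl : l < N)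
    (h : expFun 1 (((j : ℝ) - l) / N) = 1) : j = l := by
  have hN' : (N : ℝ) ≠ 0 := by
    have : N ≠ 0 := by omega
    exact_mod_cast this
  obtain ⟨n, hn⟩ := (expFun_eq_one_iff _ _).1 h
  rw [one_mul, div_eq_iff hN'] at hn
  have h2 : (j : ℤ) - l = n * N := by exact_mod_cast hn
  have h3 : n = 0 := by
    by_contra h0
    rcases lt_or_gt_of_ne h0 with h0 | h0
    · have : n * N ≤ -1 * N := by gcongr; omega
      omega
    · have : 1 * (N : ℤ) ≤ n * N := by gcongr; omega
      omega
  rw [h3] at h2; omega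

theorem sum_expFun_root {j l : ℕ} (hj : j < N) (hl : l < N) :
    ∑ n ∈ Finset.range N, expFun n (((j : ℝ) - l) / N) = if j = l then (N : ℂ) else 0 := by
  have hN' : (N : ℝ) ≠ 0 := by
    have : N ≠ 0 := by omega
    exact_mod_cast this
  split_ifs with h
  · simp [h, expFun_zero_right]
  · have h1 : expFun 1 (((j : ℝ) - l) / N) ≠ 1 := fun h1 => h (expFun_one_div_injOn N hj hl h1)
    have h2 : ∀ n ∈ Finset.range N, expFun n (((j : ℝ) - l) / N) =
        expFun 1 (((j : ℝ) - l) / N) ^ n := fun n _ => by rw [expFun_pow, mul_one]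
    rw [Finset.sum_congr rfl h2, geom_sum_eq h1, expFun_pow, mul_one, div_eq_zero_iff]
    left
    rw [sub_eq_zero]
    exact (expFun_eq_one_iff _ _).2 ⟨j - l, by push_cast; field_simp⟩

/-- Inversion of the finite Fourier transform in `j`, by orthogonality of the `N`-th roots of unity.
-/
theorem sum_foldComp (g : ℝ → ℂ) (y : ℝ) {j : ℕ} (hj : j < N) :
    ∑ n ∈ Finset.range N, expFun n ((y + j) / N) * foldComp N g n y = g ((y + j) / N) := by
  have hN' : (N : ℂ) ≠ 0 := by
    have : N ≠ 0 := by omega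
    exact_mod_cast this
  simp only [foldComp, Finset.mul_sum]
  rw [Finset.sum_comm]
  have h1 : ∀ l ∈ Finset.range N, ∑ n ∈ Finset.range N, expFun n ((y + j) / N) *
      ((N : ℂ)⁻¹ * (expFun (-n) ((y + l) / N) * g ((y + l) / N))) =
      if j = l then g ((y + l) / N) else 0 := by
    intro l hl
    have h2 : ∀ n ∈ Finset.range N, expFun n ((y + j) / N) *
      ((N : ℂ)⁻¹ * (expFun (-n) ((y + l) / N) * g ((y + l) / N))) =
        expFun n (((j : ℝ) - l) / N) * ((N : ℂ)⁻¹ * g ((y + l) / N)) := by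
      intro n _
      have e : expFun n (((j : ℝ) - l) / N) = expFun n ((y + j) / N) * expFun (-n) ((y + l) / N) := by
        have : ((j : ℝ) - l) / N = (y + j) / N + (-((y + l) / N)) := by ring
        rw [this, expFun_add_right]
        congr 1
        exact expFun_congr (by ring)
      rw [e]; ring
    rw [Finset.sum_congr rfl h2, ← Finset.sum_mul, sum_expFun_root hj (Finset.mem_range.1 hl)]
    split_ifs with h
    · field_simp
    · simp
  rw [Finset.sum_congr rfl h1, Finset.sum_ite_eq]
  simp [hj]

theorem exists_fcoeff_progression (hN : 0 < N) {H : ℕ → ℝ → ℂ} (hH : ∀ n, MemLp (H n) 2 unitVol) :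
    ∃ g, MemLp g 2 unitVol ∧ ∀ n < N, ∀ k : ℤ, fcoeff g (N * k + n) = fcoeff (H n) k := by
  have hN' : (N : ℤ) ≠ 0 := by exact_mod_cast hN.ne'
  have hσ : ∀ n : ℕ, Function.Injective fun k : ℤ => (N : ℤ) * k + n := fun n a b h => by
    simpa [hN.ne'] using h
  let G : Lp ℂ 2 unitVol :=
    ∑ n ∈ Finset.range N, synth _ (hσ n) (expBasis.repr ((hH n).toLp (H n)))
  refine ⟨G, Lp.memLp G, fun n hn k => ?_⟩
  rw [← expBasis_repr]
  have h1 : expBasis.repr G (N * k + n) = ∑ m ∈ Finset.range N,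
      expBasis.repr (synth _ (hσ m) (expBasis.repr ((hH m).toLp (H m)))) (N * k + n) := by
    simp only [G, map_sum]
    rw [lp.coeFn_sum, Finset.sum_apply]
  rw [h1, Finset.sum_eq_single_of_mem n (Finset.mem_range.2 hn)]
  · rw [repr_synth _ (hσ n), expBasis_repr_toLp]
  · intro m hm hmn
    apply repr_synth_of_notMem
    rintro ⟨l, hl⟩
    simp only at hl
    apply hmn
    have hm' := Finset.mem_range.1 hm
    have h2 : ((m : ℤ) - n) = N * (k - l) := by linarith
    have h3 : k - l = 0 := by
      -- The residues `m` and `n` lie in `[0, N)`, so a nonzero multiple of `N` is too large to be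
      -- their difference.
      by_contra h0
      rcases lt_or_gt_of_ne h0 with h0 | h0
      · have : (N : ℤ) * (k - l) ≤ N * (-1) := by gcongr; omega
        omega
      · have : (N : ℤ) * 1 ≤ N * (k - l) := by gcongr; omega
        omega
    rw [h3] at h2; omega

end folding

/-! ### Combining the level sets -/

section fold
variable {N : ℕ}

theorem progression_unique {n n' : ℕ} (hn : n < N) (hn' : n' < N) {k l : ℤ}
    (h : (N : ℤ) * k + n = N * l + n') : n = n' ∧ k = l := by
  have h1 : ((N : ℤ) * k + n) % N = n := by
    rw [Int.mul_add_emod_self_left]; exact Int.emod_eq_of_lt (by omega) (by omega)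
  have h2 : ((N : ℤ) * l + n') % N = n' := by
    rw [Int.mul_add_emod_self_left]; exact Int.emod_eq_of_lt (by omega) (by omega)
  have h3 : (n : ℤ) = n' := by rw [← h1, ← h2, h]
  refine ⟨by exact_mod_cast h3, ?_⟩
  rw [h3, add_left_inj] at h
  exact mul_left_cancel₀ (by omega) h

open scoped Classical in
/-- The indices `j < N` of the points `(y + j) / N` that lie in `S`. -/
noncomputable def foldIdx (N : ℕ) (S : Set ℝ) (y : ℝ) : Finset ℕ :=
  (Finset.range N).filter fun j => (y + j) / N ∈ S

theorem mem_foldIdx {S : Set ℝ} {y : ℝ} {j : ℕ} :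
    j ∈ foldIdx N S y ↔ j < N ∧ (y + j) / N ∈ S := by
  simp [foldIdx]

theorem card_foldIdx_le (S : Set ℝ) (y : ℝ) : (foldIdx N S y).card ≤ N :=
  (Finset.card_le_card fun _ hj => Finset.mem_range.2 (mem_foldIdx.1 hj).1).trans
    (Finset.card_range N).le

theorem measurableSet_foldIdx_eq {S : Set ℝ} (hS : MeasurableSet S) (J : Finset ℕ) :
    MeasurableSet {y | foldIdx N S y = J} := by
  have : {y | foldIdx N S y = J} = ⋂ j : ℕ, {y : ℝ | (j < N ∧ (y + j) / N ∈ S) ↔ j ∈ J} := by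
    ext y; simp [Finset.ext_iff, mem_foldIdx]
  rw [this]
  refine MeasurableSet.iInter fun j => ?_
  have hm : MeasurableSet {y : ℝ | (y + j) / N ∈ S} :=
    (show Measurable fun y : ℝ => (y + j) / N by fun_prop) hS
  exact ((MeasurableSet.const _).inter hm).iff (MeasurableSet.const _)

/-- The points over which the restriction to `S` has more than `n` sheets. -/
def foldLevel (N : ℕ) (S : Set ℝ) (n : ℕ) : Set ℝ := {y | n < (foldIdx N S y).card}

theorem expFun_one_foldPt_injOn (y : ℝ) (J : Finset ℕ) (hJ : ∀ j ∈ J, j < N) :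
    Set.InjOn (fun j : ℕ => expFun 1 ((y + j) / N)) J := by
  intro j hj l hl h
  apply expFun_one_div_injOn N (hJ j hj) (hJ l hl)
  have h1 : ((j : ℝ) - l) / N = (y + j) / N + (-((y + l) / N)) := by ring
  simp only at h
  rw [h1, expFun_add_right, h, ← expFun_add_right, add_neg_cancel, expFun_zero_right]

/-- Descending induction on `n`: once the components above `n` vanish, the values of `g` over `y`
are those of a polynomial of degree at most `n`. Over the level set of index `n` it has more than
`n` roots, so its leading coefficient, the component `n`, vanishes there, and hence everywhere by
injectivity on that level set. -/
theorem RestrBij.fold_injective {S : Set ℝ} {Λ : ℕ → Set ℤ} (hN : 0 < N)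
    (h : ∀ n < N, RestrBij (foldLevel N S n) (Λ n)) {g : ℝ → ℂ}
    (hg : HasSpec g {k | ∃ n < N, ∃ l ∈ Λ n, k = N * l + n})
    (h0 : ∀ᵐ t ∂unitVol, t ∈ S → g t = 0) : g =ᵐ[unitVol] 0 := by
  have hspec : ∀ n < N, HasSpec (foldComp N g n) (Λ n) := by
    intro n hn
    refine ⟨memLp_foldComp hg.1 n, fun k hk => ?_⟩
    rw [fcoeff_foldComp hN hg.1]
    apply hg.2
    rintro ⟨n', hn', l, hl, hkl⟩
    obtain ⟨rfl, rfl⟩ := progression_unique hn hn' hkl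
    exact hk hl
  have hstep : ∀ n < N, (∀ m, n < m → m < N → foldComp N g m =ᵐ[unitVol] 0) →
      foldComp N g n =ᵐ[unitVol] 0 := by
    intro n hn ih
    refine (h n hn).1 _ (hspec n hn) ?_
    have ih' : ∀ᵐ y ∂unitVol, ∀ m, n < m → m < N → foldComp N g m y = 0 := by
      rw [ae_all_iff]; intro m
      by_cases hm : n < m ∧ m < N
      · filter_upwards [ih m hm.1 hm.2] with y hy _ _ using hy
      · exact Filter.Eventually.of_forall fun y h1 h2 => absurd ⟨h1, h2⟩ hm
    filter_upwards [ih', ae_foldPt (N := N) h0] with y hy hy0 hlev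
    let p : Polynomial ℂ := ∑ m ∈ Finset.range (n + 1),
      Polynomial.C (foldComp N g m y) * Polynomial.X ^ m
    have hp : p = 0 := by
      refine Polynomial.eq_zero_of_degree_lt_of_eval_index_eq_zero (foldIdx N S y)
        (expFun_one_foldPt_injOn (N := N) y _ fun j hj => (mem_foldIdx.1 hj).1) ?_ ?_
      · have h1 : p.degree < (n + 1 : ℕ) := by
          refine (Polynomial.degree_sum_le _ _).trans_lt ?_
          rw [Finset.sup_lt_iff (WithBot.bot_lt_coe _)]
          intro m hm
          refine (Polynomial.degree_C_mul_X_pow_le _ _).trans_lt ?_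
          exact_mod_cast Finset.mem_range.1 hm
        refine h1.trans_le ?_
        exact_mod_cast (show n + 1 ≤ (foldIdx N S y).card from hlev)
      · intro j hj
        obtain ⟨hj1, hj2⟩ := mem_foldIdx.1 hj
        have h1 := sum_foldComp g y hj1
        rw [hy0 j hj1 hj2] at h1
        rw [← h1, Polynomial.eval_finsetSum]
        rw [← Finset.sum_subset (Finset.range_mono (show n + 1 ≤ N from hn))]
        · refine Finset.sum_congr rfl fun m _ => ?_
          simp only [Polynomial.eval_mul, Polynomial.eval_C, Polynomial.eval_pow,
            Polynomial.eval_X, expFun_pow, mul_one]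
          ring
        · intro m hm1 hm2
          rw [hy m (by simpa using hm2) (by simpa using hm1), mul_zero]
    have h2 : p.coeff n = foldComp N g n y := by
      simp [p, Polynomial.finsetSum_coeff, Polynomial.coeff_X_pow]
    rw [← h2, hp, Polynomial.coeff_zero]
  have hall : ∀ d, ∀ n < N, N ≤ n + d → foldComp N g n =ᵐ[unitVol] 0 := by
    intro d
    induction d with
    | zero => intro n h1 h2; omega
    | succ d ih =>
      intro n hn hd
      exact hstep n hn fun m hm1 hm2 => ih m hm2 (by omega)
  apply ae_of_ae_foldPt hN
  have hall' : ∀ᵐ y ∂unitVol, ∀ n < N, foldComp N g n y = 0 := by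
    rw [ae_all_iff]; intro n
    by_cases hn : n < N
    · filter_upwards [hall N n hn (by omega)] with y hy _ using hy
    · exact Filter.Eventually.of_forall fun y h => absurd h hn
  filter_upwards [hall'] with y hy j hj
  rw [← sum_foldComp g y hj]
  exact Finset.sum_eq_zero fun n hn => by rw [hy n (Finset.mem_range.1 hn), mul_zero]

/-- The remainder at the point `(y + i) / N` after removing the components of index `≥ k`. -/
noncomputable def foldRem (N : ℕ) (u : ℝ → ℂ) (H : ℕ → ℝ → ℂ) (k i : ℕ) (y : ℝ) : ℂ :=
  u ((y + i) / N) - ∑ m ∈ Finset.Ico k N, expFun m ((y + i) / N) * H m y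

/-- The component of index `n < #J` that interpolates the remainders at the points of `J`. -/
noncomputable def foldTarget (N : ℕ) (u : ℝ → ℂ) (H : ℕ → ℝ → ℂ) (n : ℕ) (J : Finset ℕ) (y : ℝ) : ℂ :=
  ∑ i ∈ J, (Lagrange.basis J (fun j : ℕ => expFun 1 ((0 + j) / N)) i).coeff n *
    (expFun (-n) (y / N) * foldRem N u H J.card i y)

/-- Lagrange interpolation at the nodes `e_1 ((y + j) / N)`. They are the nodes for `y = 0` times
the common factor `e_1 (y / N)`, which is absorbed into the phase `e_{-n} (y / N)`; the basis
coefficients are therefore constants, and square integrability in `y` is immediate. -/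
theorem sum_foldTarget (u : ℝ → ℂ) (H : ℕ → ℝ → ℂ) (J : Finset ℕ) (hJ : ∀ j ∈ J, j < N) (y : ℝ)
    {j : ℕ} (hj : j ∈ J) :
    ∑ n ∈ Finset.range J.card, expFun n ((y + j) / N) * foldTarget N u H n J y =
      foldRem N u H J.card j y := by
  have hinj := expFun_one_foldPt_injOn (N := N) 0 J hJ
  simp only [foldTarget, Finset.mul_sum]
  rw [Finset.sum_comm]
  have h1 : ∀ i ∈ J, ∑ n ∈ Finset.range J.card, expFun n ((y + j) / N) *
      ((Lagrange.basis J (fun j : ℕ => expFun 1 ((0 + j) / N)) i).coeff n *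
      (expFun (-n) (y / N) * foldRem N u H J.card i y)) =
      if i = j then foldRem N u H J.card i y else 0 := by
    intro i hi
    have h2 : (Lagrange.basis J (fun j : ℕ => expFun 1 ((0 + j) / N)) i).eval
        (expFun 1 ((0 + j) / N)) = if i = j then 1 else 0 := by
      split_ifs with hij
      · rw [hij]; exact Lagrange.eval_basis_self hinj hj
      · exact Lagrange.eval_basis_of_ne (v := fun j : ℕ => expFun 1 ((0 + j) / N)) hij hj
    have hcard : 0 < J.card := Finset.card_pos.2 ⟨i, hi⟩
    rw [Polynomial.eval_eq_sum_range' (n := J.card)] at h2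
    · have h3 : ∀ n ∈ Finset.range J.card, expFun n ((y + j) / N) *
        ((Lagrange.basis J (fun j : ℕ => expFun 1 ((0 + j) / N)) i).coeff n *
        (expFun (-n) (y / N) * foldRem N u H J.card i y)) =
          ((Lagrange.basis J (fun j : ℕ => expFun 1 ((0 + j) / N)) i).coeff n *
            expFun 1 ((0 + j) / N) ^ n) * foldRem N u H J.card i y := by
        intro n _
        have e : expFun n ((y + j) / N) * expFun (-n) (y / N) = expFun 1 ((0 + j) / N) ^ n := by
          rw [expFun_pow, mul_one, zero_add, add_div, expFun_add_right]
          have : expFun n (y / N) * expFun (-n) (y / N) = 1 := by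
            rw [← expFun_add_left, add_neg_cancel, expFun_zero_left]
          linear_combination expFun n (j / N) * this
        rw [← e]; ring
      rw [Finset.sum_congr rfl h3, ← Finset.sum_mul, h2]
      split_ifs <;> simp
    · rw [Polynomial.natDegree_lt_iff_degree_lt (Lagrange.basis_ne_zero hinj hi),
        Lagrange.degree_basis hinj hi]
      exact_mod_cast Nat.sub_lt hcard one_pos
  rw [Finset.sum_congr rfl h1, Finset.sum_ite_eq']
  simp [hj]

theorem memLp_foldTarget {u : ℝ → ℂ} (hu : MemLp u 2 unitVol) {H : ℕ → ℝ → ℂ}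
    (hH : ∀ n, MemLp (H n) 2 unitVol) (n : ℕ) (J : Finset ℕ) (hJ : ∀ j ∈ J, j < N) :
    MemLp (foldTarget N u H n J) 2 unitVol := by
  refine memLp_finsetSum J fun i hi => MemLp.const_mul ?_ _
  refine MemLp.expFun_mul (φ := fun y => y / N) ?_ _ (by fun_prop)
  refine (MemLp.comp_foldPt (hJ i hi) hu).sub ?_
  exact memLp_finsetSum _ fun m _ =>
    (hH m).expFun_mul _ (φ := fun y => (y + i) / N) (by fun_prop)

/-- The target for a level `n < J.card` uses only components of index at least `J.card`, hence above
`n`. This makes the descending construction consistent. -/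
theorem foldTarget_congr {u : ℝ → ℂ} {H H' : ℕ → ℝ → ℂ} {n : ℕ} {J : Finset ℕ}
    (h : ∀ m, J.card ≤ m → H m = H' m) : foldTarget N u H n J = foldTarget N u H' n J := by
  ext y
  simp only [foldTarget, foldRem]
  refine Finset.sum_congr rfl fun i _ => ?_
  congr 3
  exact Finset.sum_congr rfl fun m hm => by rw [h m (Finset.mem_Ico.1 hm).1]

/-- The components are built from the top index down, `d` of them after `d` steps. The new component
has its values prescribed only on its level set, and surjectivity there extends them with spectrum
in `Λ n`. -/
theorem RestrBij.exists_fold_components {S : Set ℝ} (hS : MeasurableSet S) {Λ : ℕ → Set ℤ}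
    (h : ∀ n < N, RestrBij (foldLevel N S n) (Λ n)) {u : ℝ → ℂ}
    (hu : MemLp u 2 unitVol) (d : ℕ) : d ≤ N → ∃ H : ℕ → ℝ → ℂ, (∀ n, MemLp (H n) 2 unitVol) ∧
      ∀ n < N, N ≤ n + d → HasSpec (H n) (Λ n) ∧ ∀ᵐ y ∂unitVol, n < (foldIdx N S y).card →
        H n y = foldTarget N u H n (foldIdx N S y) y := by
  classical
  induction d with
  | zero => exact fun _ => ⟨0, fun _ => MemLp.zero, fun n h1 h2 => by omega⟩
  | succ d ih =>
    intro hd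
    obtain ⟨H, hH, hH2⟩ := ih (by omega)
    obtain ⟨n0, hn0⟩ : ∃ n0, N = n0 + (d + 1) := ⟨N - (d + 1), by omega⟩
    -- The target is glued over the finitely many possible index sets, each attained on a measurable
    -- set.
    let w : ℝ → ℂ := fun y => ∑ J ∈ (Finset.range N).powerset,
      Set.indicator {y | foldIdx N S y = J} (foldTarget N u H n0 J) y
    have hw : MemLp w 2 unitVol := memLp_finsetSum _ fun J hJ =>
      (memLp_foldTarget hu hH n0 J fun j hj =>
        Finset.mem_range.1 (Finset.mem_powerset.1 hJ hj)).indicator (measurableSet_foldIdx_eq hS J)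
    have hw2 : ∀ y, w y = foldTarget N u H n0 (foldIdx N S y) y := by
      intro y
      simp only [w, Set.indicator_apply, Set.mem_ofPred_eq]
      rw [Finset.sum_ite_eq, if_pos]
      exact Finset.mem_powerset.2 fun j hj => Finset.mem_range.2 (mem_foldIdx.1 hj).1
    obtain ⟨g, hg, hgw⟩ := (h n0 (by omega)).2 w hw
    have hcongr : ∀ n (J : Finset ℕ), n0 ≤ n → n < J.card → 
        foldTarget N u (Function.update H n0 g) n J = foldTarget N u H n J := by
      intro n J h1 h2
      refine foldTarget_congr fun m hm => ?_
      rw [Function.update_of_ne (by omega)]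
    refine ⟨Function.update H n0 g, fun n => ?_, fun n hn hnd => ?_⟩
    · by_cases hnn : n = n0
      · rw [hnn, Function.update_self]; exact hg.1
      · rw [Function.update_of_ne hnn]; exact hH n
    · by_cases hnn : n = n0
      · rw [hnn, Function.update_self]
        refine ⟨hg, ?_⟩
        filter_upwards [hgw] with y hy hc
        rw [hcongr n0 _ le_rfl hc, hy hc, hw2]
      · rw [Function.update_of_ne hnn]
        obtain ⟨h1, h2⟩ := hH2 n hn (by omega)
        refine ⟨h1, ?_⟩
        filter_upwards [h2] with y hy hc
        rw [hcongr n _ (by omega) hc, hy hc]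

/-- Restriction operators of the level sets of the folding combine into one for `S`. -/
theorem RestrBij.fold {S : Set ℝ} (hS : MeasurableSet S) {Λ : ℕ → Set ℤ} (hN : 0 < N)
    (h : ∀ n < N, RestrBij (foldLevel N S n) (Λ n)) :
    RestrBij S {k | ∃ n < N, ∃ l ∈ Λ n, k = N * l + n} := by
  refine ⟨fun g hg h0 => RestrBij.fold_injective hN h hg h0, fun u hu => ?_⟩
  obtain ⟨H, hH, hH2⟩ := RestrBij.exists_fold_components hS h hu N le_rfl
  obtain ⟨g, hg, hgH⟩ := exists_fcoeff_progression hN hH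
  refine ⟨g, ⟨hg, fun k hk => ?_⟩, ?_⟩
  · have hN' : (N : ℤ) ≠ 0 := by exact_mod_cast hN.ne'
    have h1 : k = N * (k / N) + ((k % N).toNat : ℤ) := by
      rw [Int.toNat_of_nonneg (Int.emod_nonneg _ hN')]; exact (Int.mul_ediv_add_emod k N).symm
    have h2 : (k % N).toNat < N := by
      have := Int.emod_lt_of_pos k (show (0 : ℤ) < N by exact_mod_cast hN)
      omega
    rw [h1, hgH _ h2]
    refine (hH2 _ h2 (by omega)).1.2 _ fun hl => hk ⟨_, h2, _, hl, h1⟩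
  · apply ae_of_ae_foldPt hN
    have h1 : ∀ᵐ y ∂unitVol, ∀ n < N, foldComp N g n y = H n y ∧ (n < (foldIdx N S y).card →
        H n y = foldTarget N u H n (foldIdx N S y) y) := by
      rw [ae_all_iff]; intro n
      by_cases hn : n < N
      · have : foldComp N g n =ᵐ[unitVol] H n := ae_eq_of_fcoeff (memLp_foldComp hg n) (hH n)
          fun k => by rw [fcoeff_foldComp hN hg, hgH n hn]
        filter_upwards [this, (hH2 n hn (by omega)).2] with y h1 h2 _ using ⟨h1, h2⟩
      · exact Filter.Eventually.of_forall fun y h => absurd h hn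
    filter_upwards [h1] with y hy j hj hjS
    have h2 := sum_foldTarget u H (foldIdx N S y) (fun j hj => (mem_foldIdx.1 hj).1) y
      (mem_foldIdx.2 ⟨hj, hjS⟩)
    -- The components below the number of sheets interpolate the remainder, and the remainder was
    -- formed by subtracting all the others.
    rw [← sum_foldComp g y hj, ← Finset.sum_range_add_sum_Ico _ (card_foldIdx_le (N := N) S y)]
    have h3 : ∑ n ∈ Finset.range (foldIdx N S y).card, expFun n ((y + j) / N) * foldComp N g n y =
        foldRem N u H (foldIdx N S y).card j y := by
      rw [← h2]
      refine Finset.sum_congr rfl fun n hn => ?_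
      have hn' := Finset.mem_range.1 hn
      obtain ⟨h4, h5⟩ := hy n (hn'.trans_le (card_foldIdx_le S y))
      rw [h4, h5 hn']
    rw [h3, foldRem, sub_add_eq_add_sub, sub_eq_iff_eq_add]
    congr 1
    exact Finset.sum_congr rfl fun n hn => by rw [(hy n (Finset.mem_Ico.1 hn).2).1]

end fold

/-! ### Perturbation of the exponential basis -/

theorem norm_toLp_sq {f : ℝ → ℂ} (hf : MemLp f 2 unitVol) :
    ‖hf.toLp f‖ ^ 2 = ∫ t, ‖f t‖ ^ 2 ∂unitVol := by
  have h1 : inner ℂ (hf.toLp f) (hf.toLp f) = ((∫ t, ‖f t‖ ^ 2 ∂unitVol : ℝ) : ℂ) := by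
    rw [L2.inner_def, ← integral_complex_ofReal]
    apply integral_congr_ae
    filter_upwards [hf.coeFn_toLp] with t ht
    rw [ht, inner_self_eq_norm_sq_to_K]
    norm_cast
  rw [inner_self_eq_norm_sq_to_K] at h1
  exact RCLike.ofReal_injective (K := ℂ) (by rw [RCLike.ofReal_pow]; exact h1)

theorem memLp_of_continuous {f : ℝ → ℂ} (hf : Continuous f) : MemLp f 2 unitVol := by
  obtain ⟨C, hC⟩ := (isCompact_Icc (a := (0:ℝ)) (b := 1)).exists_bound_of_continuousOn hf.continuousOn
  refine MemLp.of_bound hf.aestronglyMeasurable C ?_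
  filter_upwards [ae_restrict_mem measurableSet_Ioc] with t ht
  exact hC t (Set.Ioc_subset_Icc_self ht)

theorem sum_smul_expBasis (s : Finset ℤ) (c : ℤ → ℂ) :
    (∑ n ∈ s, c n • expBasis n : Lp ℂ 2 unitVol) =ᵐ[unitVol] fun t => ∑ n ∈ s, c n * expFun n t := by
  have h1 : ∀ n ∈ s, (c n • expBasis n : Lp ℂ 2 unitVol) =ᵐ[unitVol] fun t => c n * expFun n t := by
    intro n _
    filter_upwards [Lp.coeFn_smul (c n) (expBasis n), coeFn_expBasis n] with t h1 h2
    rw [h1, Pi.smul_apply, h2, smul_eq_mul]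
  refine (Lp.coeFn_finsetSum s _).trans ?_
  have h2 : ∀ᵐ t ∂unitVol, ∀ n ∈ s, (c n • expBasis n : Lp ℂ 2 unitVol) t = c n * expFun n t := by
    rw [Finset.eventually_all]; exact h1
  filter_upwards [h2] with t ht
  rw [Finset.sum_apply]
  exact Finset.sum_congr rfl ht

theorem norm_sum_smul_expBasis_sq (s : Finset ℤ) (c : ℤ → ℂ) :
    ‖∑ n ∈ s, c n • expBasis n‖ ^ 2 = ∑ n ∈ s, ‖c n‖ ^ 2 := by
  have h := expBasis.orthonormal.inner_sum c c s
  rw [inner_self_eq_norm_sq_to_K] at h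
  have h2 : ∀ n ∈ s, (starRingEnd ℂ) (c n) * c n = ((‖c n‖ ^ 2 : ℝ) : ℂ) := by
    intro n _
    rw [mul_comm, Complex.mul_conj, Complex.normSq_eq_norm_sq]
  rw [Finset.sum_congr rfl h2, ← Complex.ofReal_sum] at h
  exact RCLike.ofReal_injective (K := ℂ) (by rw [RCLike.ofReal_pow]; exact h)

theorem integral_norm_sum_sq (s : Finset ℤ) (c : ℤ → ℂ) :
    ∫ t, ‖∑ n ∈ s, c n * expFun n t‖ ^ 2 ∂unitVol = ∑ n ∈ s, ‖c n‖ ^ 2 := by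
  have hm : MemLp (fun t => ∑ n ∈ s, c n * expFun n t) 2 unitVol :=
    memLp_of_continuous (by fun_prop)
  rw [← norm_sum_smul_expBasis_sq, ← norm_toLp_sq hm]
  congr 2
  exact Lp.ext (hm.coeFn_toLp.trans (sum_smul_expBasis s c).symm)

theorem sq_integral_le_integral_sq {f : ℝ → ℝ} (hf : MemLp f 2 unitVol) :
    (∫ t, f t ∂unitVol) ^ 2 ≤ ∫ t, f t ^ 2 ∂unitVol := by
  have h := ProbabilityTheory.variance_nonneg f unitVol
  rw [ProbabilityTheory.variance_eq_sub hf] at h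
  simpa using h

theorem expFun_sub_one_eq (a t : ℝ) :
    expFun a t - 1 = ∫ s in (0 : ℝ)..t, (2 * Real.pi * a * Complex.I) * expFun a s := by
  have h : ∀ s ∈ Set.uIcc 0 t, HasDerivAt (expFun a) ((2 * Real.pi * a * Complex.I) * expFun a s) s := by
    intro s _
    have h1 : HasDerivAt (fun s : ℝ => 2 * Real.pi * Complex.I * a * (s : ℂ))
        (2 * Real.pi * Complex.I * a * 1) s := (hasDerivAt_id s).ofReal_comp.const_mul _
    have h2 := h1.cexp
    unfold expFun
    convert! h2 using 1
    ring
  rw [intervalIntegral.integral_eq_sub_of_hasDerivAt h, expFun_zero_right]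
  exact Continuous.intervalIntegrable (by fun_prop) _ _

/-- Writing `e_ε t - 1` as an integral over `[0, t]` turns the perturbation into `∫ r in 0..t, G r
t`, where for fixed `r` the function `G r` is a trigonometric polynomial with coefficients of size
at most `2 π δ ‖c n‖`. Cauchy–Schwarz in `r`, Fubini and Parseval in `t` give the bound. -/
theorem integral_perturbation_le (s : Finset ℤ) (c : ℤ → ℂ) (ε : ℤ → ℝ) {δ : ℝ} (hδ : ∀ n, |ε n| ≤ δ) :
    ∫ t, ‖∑ n ∈ s, c n * (expFun n t - expFun (n + ε n) t)‖ ^ 2 ∂unitVol ≤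
      (2 * Real.pi * δ) ^ 2 * ∑ n ∈ s, ‖c n‖ ^ 2 := by
  let d : ℤ → ℝ → ℂ := fun n r => -(c n * (2 * Real.pi * ε n * Complex.I) * expFun (ε n) r)
  let G : ℝ → ℝ → ℂ := fun r t => ∑ n ∈ s, d n r * expFun n t
  have hd : ∀ n, Continuous (d n) := fun n => by fun_prop
  have hG : Continuous (Function.uncurry G) := by
    simp only [G, Function.uncurry_def]
    refine continuous_finsetSum s fun n _ => ?_
    exact ((hd n).comp continuous_fst).mul ((continuous_expFun n).comp continuous_snd)
  have hGr : ∀ t, Continuous fun r => G r t := fun t =>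
    continuous_finsetSum s fun n _ => (hd n).mul continuous_const
  have hF : ∀ t, ∑ n ∈ s, c n * (expFun n t - expFun (n + ε n) t) = ∫ r in (0 : ℝ)..t, G r t := by
    intro t
    simp only [G]
    rw [intervalIntegral.integral_finsetSum
      (fun n _ => Continuous.intervalIntegrable (by have := hd n; fun_prop) _ _)]
    refine Finset.sum_congr rfl fun n _ => ?_
    rw [intervalIntegral.integral_mul_const]
    simp only [d]
    have := expFun_sub_one_eq (ε n) t
    rw [intervalIntegral.integral_neg]
    simp_rw [mul_assoc (c n)]
    rw [intervalIntegral.integral_const_mul, ← this, expFun_add_left]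
    ring
  have hpt : ∀ t ∈ Set.Ioc (0 : ℝ) 1, ‖∑ n ∈ s, c n * (expFun n t - expFun (n + ε n) t)‖ ^ 2 ≤
      ∫ r, ‖G r t‖ ^ 2 ∂unitVol := by
    intro t ht
    have h1 : ‖∫ r in (0 : ℝ)..t, G r t‖ ≤ ∫ r, ‖G r t‖ ∂unitVol := by
      refine (intervalIntegral.norm_integral_le_integral_norm ht.1.le).trans ?_
      rw [intervalIntegral.integral_of_le ht.1.le]
      refine setIntegral_mono_set ((hGr t).norm.integrableOn_Ioc)
        (Filter.Eventually.of_forall fun _ => norm_nonneg _)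
        (Filter.Eventually.of_forall (Set.Ioc_subset_Ioc_right ht.2))
    rw [hF t]
    have h2 : MemLp (fun r => ‖G r t‖) 2 unitVol := (memLp_of_continuous (hGr t)).norm
    exact (pow_le_pow_left₀ (norm_nonneg _) h1 2).trans (sq_integral_le_integral_sq h2)
  have hbox : Integrable (Function.uncurry fun t r => ‖G r t‖ ^ 2) (unitVol.prod unitVol) := by
    have hc : Continuous (Function.uncurry fun t r => ‖G r t‖ ^ 2) := by
      have : (Function.uncurry fun t r => ‖G r t‖ ^ 2) =
          fun p : ℝ × ℝ => ‖Function.uncurry G (p.2, p.1)‖ ^ 2 := rfl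
      rw [this]; fun_prop
    rw [Measure.prod_restrict]
    exact (hc.continuousOn.integrableOn_compact (isCompact_Icc.prod isCompact_Icc)).mono_set
      (Set.prod_mono Set.Ioc_subset_Icc_self Set.Ioc_subset_Icc_self)
  have hint : Integrable (fun t => ‖∑ n ∈ s, c n * (expFun n t - expFun (n + ε n) t)‖ ^ 2) unitVol :=
    (memLp_of_continuous (by fun_prop)).integrable_norm_pow (by norm_num)
  calc ∫ t, ‖∑ n ∈ s, c n * (expFun n t - expFun (n + ε n) t)‖ ^ 2 ∂unitVol
      ≤ ∫ t, ∫ r, ‖G r t‖ ^ 2 ∂unitVol ∂unitVol := by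
        refine integral_mono_ae hint hbox.integral_prod_left ?_
        filter_upwards [ae_restrict_mem measurableSet_Ioc] with t ht using hpt t ht
    _ = ∫ r, ∫ t, ‖G r t‖ ^ 2 ∂unitVol ∂unitVol := integral_integral_swap hbox
    _ ≤ ∫ r, (2 * Real.pi * δ) ^ 2 * ∑ n ∈ s, ‖c n‖ ^ 2 ∂unitVol := by
        refine integral_mono_ae (hbox.integral_prod_right) (integrable_const _) ?_
        refine Filter.Eventually.of_forall fun r => ?_
        simp only [G]
        rw [integral_norm_sum_sq, Finset.mul_sum]
        refine Finset.sum_le_sum fun n _ => ?_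
        have h1 : ‖d n r‖ = ‖c n‖ * (2 * Real.pi * |ε n|) := by
          simp [d, norm_expFun, abs_of_pos Real.pi_pos]
        rw [h1, mul_pow, mul_comm]
        have := hδ n
        have := Real.pi_pos
        gcongr
    _ = _ := by simp

/-- Small perturbations of the orthonormal basis of exponentials are Riesz bases. -/
theorem exists_equiv_perturbation (ε : ℤ → ℝ) {δ : ℝ} (hδ : ∀ n, |ε n| ≤ δ)
    (h1 : 2 * Real.pi * δ < 1) : ∃ V : Lp ℂ 2 unitVol ≃L[ℂ] Lp ℂ 2 unitVol,
      ∀ n, V (expBasis n) =ᵐ[unitVol] expFun (n + ε n) := by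
  have hδ0 : 0 ≤ δ := (abs_nonneg _).trans (hδ 0)
  have hm : ∀ n : ℤ, MemLp (fun t => expFun n t - expFun (n + ε n) t) 2 unitVol :=
    fun n => memLp_of_continuous (by fun_prop)
  let D : ℤ → Lp ℂ 2 unitVol := fun n => (hm n).toLp _
  let e : (ℤ →₀ ℂ) →ₗ[ℂ] Lp ℂ 2 unitVol := Finsupp.linearCombination ℂ expBasis
  let f : (ℤ →₀ ℂ) →ₗ[ℂ] Lp ℂ 2 unitVol := Finsupp.linearCombination ℂ D
  have hdense : DenseRange e := by
    have h2 := expBasis.dense_span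
    rw [← Submodule.dense_iff_topologicalClosure_eq_top, ← Finsupp.range_linearCombination] at h2
    exact h2
  have hbound : ∀ c, ‖f c‖ ≤ 2 * Real.pi * δ * ‖e c‖ := by
    intro c
    have hF : MemLp (fun t => ∑ n ∈ c.support, c n * (expFun n t - expFun (n + ε n) t)) 2 unitVol :=
      memLp_of_continuous (by fun_prop)
    have h2 : f c = hF.toLp _ := by
      simp only [f, Finsupp.linearCombination_apply, Finsupp.sum]
      apply Lp.ext
      refine (Lp.coeFn_finsetSum _ _).trans (Filter.EventuallyEq.trans ?_ hF.coeFn_toLp.symm)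
      have h3 : ∀ᵐ t ∂unitVol, ∀ n ∈ c.support, (c n • D n : Lp ℂ 2 unitVol) t =
          c n * (expFun n t - expFun (n + ε n) t) := by
        rw [Finset.eventually_all]; intro n _
        filter_upwards [Lp.coeFn_smul (c n) (D n), (hm n).coeFn_toLp] with t h1 h2
        rw [h1, Pi.smul_apply, h2, smul_eq_mul]
      filter_upwards [h3] with t ht
      rw [Finset.sum_apply]
      exact Finset.sum_congr rfl ht
    have h3 : ‖f c‖ ^ 2 ≤ (2 * Real.pi * δ * ‖e c‖) ^ 2 := by
      rw [h2, norm_toLp_sq, mul_pow]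
      have h4 : ‖e c‖ ^ 2 = ∑ n ∈ c.support, ‖c n‖ ^ 2 := by
        simp only [e, Finsupp.linearCombination_apply, Finsupp.sum]
        exact norm_sum_smul_expBasis_sq _ _
      rw [h4]
      exact integral_perturbation_le _ _ ε hδ
    exact le_of_sq_le_sq h3 (by have := Real.pi_pos; positivity)
  -- `K` sends each `e_n` to its error `D n` and has norm below one, so `1 - K` is invertible by the
  -- Neumann series.
  let K : Lp ℂ 2 unitVol →L[ℂ] Lp ℂ 2 unitVol := f.extendOfNorm e
  have hK : ‖K‖ < 1 := (LinearMap.opNorm_extendOfNorm_le hdense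
    (by have := Real.pi_pos; positivity) hbound).trans_lt h1
  have hKb : ∀ n, K (expBasis n) = D n := by
    intro n
    have := LinearMap.extendOfNorm_eq hdense ⟨_, hbound⟩ (Finsupp.single n 1)
    simpa [e, f] using this
  refine ⟨ContinuousLinearEquiv.unitsEquiv ℂ _ (Units.oneSub K hK), fun n => ?_⟩
  have h2 : ContinuousLinearEquiv.unitsEquiv ℂ _ (Units.oneSub K hK) (expBasis n) =
      expBasis n - D n := by rw [← hKb]; rfl
  rw [h2]
  filter_upwards [Lp.coeFn_sub (expBasis n) (D n), coeFn_expBasis n, (hm n).coeFn_toLp]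
    with t h1 h2 h3
  rw [h1, Pi.sub_apply, h2, h3]; ring

/-- Short intervals at the origin admit a Riesz basis of exponentials with integer frequencies. -/
theorem exists_restrBij_Ioc {θ : ℝ} (h0 : 0 < θ) (h1 : θ ≤ 1 / 4) :
    ∃ Λ, RestrBij (Set.Ioc 0 θ) Λ := by
  -- Dilation by `θ` turns `e_{σ n}` into `e_{θ σ n}`, and rounding leaves `θ σ n` within `θ / 2 ≤ 1
  -- / 8` of `n`; then `2 π / 8 < 1`.
  let σ : ℤ → ℤ := fun n => round (n / θ)
  have hσr : ∀ n : ℤ, |(n : ℝ) / θ - σ n| ≤ 1 / 2 := fun n => abs_sub_round _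
  have hσ : Function.Injective σ := by
    intro a b hab
    have ha := abs_le.1 (hσr a)
    have hb := abs_le.1 (hσr b)
    rw [hab] at ha
    have h2 : |(a : ℝ) / θ - b / θ| ≤ 1 := abs_le.2 ⟨by linarith [ha.1, hb.2], by linarith [ha.2, hb.1]⟩
    rw [← sub_div, abs_div, abs_of_pos h0, div_le_one h0] at h2
    have h3 : |((a - b : ℤ) : ℝ)| < 1 := by push_cast; linarith
    have h4 : |a - b| < 1 := by exact_mod_cast h3
    have := Int.abs_lt_one_iff.1 h4
    omega
  obtain ⟨V, hV⟩ := exists_equiv_perturbation (fun n => θ * σ n - n) (δ := θ / 2) (by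
    intro n
    have : θ * σ n - n = -(θ * ((n : ℝ) / θ - σ n)) := by field_simp; ring
    rw [this, abs_neg, abs_mul, abs_of_pos h0]
    nlinarith [hσr n]) (by nlinarith [Real.pi_lt_four, Real.pi_pos])
  have hmap : unitVol.map (fun t => θ * t + 0) ≤ ENNReal.ofReal θ⁻¹ • unitVol :=
    map_affine_unitVol_le h0 fun y hy => ⟨by nlinarith [hy.1], by nlinarith [hy.1, hy.2]⟩
  have hφ : Measurable fun t : ℝ => θ * t + 0 := by fun_prop
  let Dil := compLp hφ ENNReal.ofReal_ne_top hmap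
  -- Dilation after synthesis is the perturbed basis operator `V`, which is invertible; both halves
  -- of the bijection follow.
  have hfac : ∀ a : lp (fun _ : ℤ => ℂ) 2, Dil (synth σ hσ a) = V (expBasis.repr.symm a) := by
    have h2 : (Dil.comp (synth σ hσ).toContinuousLinearMap).comp
        (expBasis.repr : Lp ℂ 2 unitVol →L[ℂ] lp (fun _ : ℤ => ℂ) 2) = V := by
      refine ContinuousLinearMap.ext_on (s := Set.range expBasis)
        (Submodule.dense_iff_topologicalClosure_eq_top.2 expBasis.dense_span) ?_
      rintro _ ⟨n, rfl⟩
      have h3 : expBasis.repr (expBasis n) = lp.single 2 n 1 := by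
        classical exact expBasis.repr_self n
      change Dil (synth σ hσ (expBasis.repr (expBasis n))) = V (expBasis n)
      rw [h3, synth_single]
      refine Lp.ext ((compLp_expBasis hφ _ hmap _).trans (Filter.EventuallyEq.trans ?_ (hV n).symm))
      exact Filter.Eventually.of_forall fun t => expFun_congr (by ring)
    intro a
    have := congrArg (fun F => F (expBasis.repr.symm a)) h2
    simpa using this
  have hquasi := quasiMeasurePreserving_of_map_le hφ hmap
  refine ⟨Set.range σ, fun g hg hg0 => ?_, fun u hu => ?_⟩
  · obtain ⟨a, ha⟩ := exists_synth_eq σ hσ (hg.1.toLp g) (by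
      intro l hl; rw [expBasis_repr_toLp]; exact hg.2 l hl)
    have h2 : Dil (hg.1.toLp g) = 0 := by
      rw [Lp.eq_zero_iff_ae_eq_zero]
      refine (coeFn_compLp hφ _ hmap _).trans ?_
      filter_upwards [hquasi.ae hg0, hquasi.ae hg.1.coeFn_toLp, ae_restrict_mem measurableSet_Ioc]
        with t h3 h4 h5
      rw [Function.comp_apply, h4]
      exact h3 ⟨by nlinarith [h5.1], by nlinarith [h5.2]⟩
    rw [← ha, hfac] at h2
    have h3 : a = 0 := by simpa using h2
    rw [h3, map_zero] at ha
    exact hg.1.coeFn_toLp.symm.trans (Lp.eq_zero_iff_ae_eq_zero.1 ha.symm)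
  · let a := expBasis.repr (V.symm (Dil (hu.toLp u)))
    refine ⟨synth σ hσ a, ⟨Lp.memLp _, fun k hk => ?_⟩, ?_⟩
    · rw [← expBasis_repr]; exact repr_synth_of_notMem σ hσ a hk
    · have h2 : Dil (synth σ hσ a) = Dil (hu.toLp u) := by rw [hfac]; simp [a]
      have h3 : ∀ᵐ t ∂unitVol, synth σ hσ a (θ * t + 0) = u (θ * t + 0) := by
        filter_upwards [coeFn_compLp hφ ENNReal.ofReal_ne_top hmap (synth σ hσ a),
          coeFn_compLp hφ ENNReal.ofReal_ne_top hmap (hu.toLp u), hquasi.ae hu.coeFn_toLp]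
          with t h4 h5 h6
        rw [← h6]
        exact h4.symm.trans ((congrArg (fun F : Lp ℂ 2 unitVol => F t) h2).trans h5)
      rw [ae_restrict_iff' measurableSet_Ioc] at h3 ⊢
      filter_upwards [(quasiMeasurePreserving_affine 0 (inv_ne_zero h0.ne')).ae h3] with t ht _ htI
      have e : θ * (θ⁻¹ * t + 0) + 0 = t := by field_simp; ring
      rw [e] at ht
      refine ht ⟨?_, ?_⟩
      · have := htI.1; positivity
      · rw [add_zero, inv_mul_le_iff₀ h0, mul_one]; exact htI.2

/-! ### Rotations and arcs -/

/-- Rotation of the unit interval modulo one. -/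
theorem exists_rotation (a : ℝ) : ∃ φ : ℝ → ℝ, MeasurePreserving φ unitVol unitVol ∧
    ∀ t, φ t ∈ Set.Ioc (0 : ℝ) 1 ∧ ∃ n : ℤ, φ t = t + a + n := by
  let r : AddCircle (1 : ℝ) → ℝ := fun z => (AddCircle.equivIoc (1 : ℝ) 0 z : ℝ)
  obtain ⟨r', hr', hr'2⟩ := exists_measurePreserving_circle_unitVol
  have hrI : ∀ z, r z ∈ Set.Ioc (0 : ℝ) 1 := fun z => by
    simpa using (AddCircle.equivIoc (1 : ℝ) 0 z).2
  have hrc : ∀ z, ((r z : ℝ) : AddCircle (1 : ℝ)) = z := fun _ => AddCircle.coe_equivIoc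
  have hrr : r' = r := by
    ext z
    conv_lhs => rw [← hrc z]
    exact hr'2 _ (hrI z)
  rw [hrr] at hr'
  refine ⟨fun t => r ((t : AddCircle (1 : ℝ)) + (a : AddCircle (1 : ℝ))), ?_, fun t => ⟨hrI _, ?_⟩⟩
  · exact hr'.comp ((measurePreserving_add_right _ _).comp measurePreserving_unitVol_circle)
  · have h1 := hrc ((t : AddCircle (1 : ℝ)) + (a : AddCircle (1 : ℝ)))
    rw [← AddCircle.coe_add, ← sub_eq_zero, ← AddCircle.coe_sub, AddCircle.coe_eq_zero_iff] at h1
    obtain ⟨n, hn⟩ := h1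
    refine ⟨n, ?_⟩
    rw [zsmul_eq_mul, mul_one] at hn
    simp only [← AddCircle.coe_add]; linarith

/-- A rotation multiplies the coefficient of index `k` by the unimodular constant `e_k a`. -/
theorem HasSpec.comp_rotation {g : ℝ → ℂ} {Λ : Set ℤ} (hg : HasSpec g Λ) {a : ℝ} {φ : ℝ → ℝ}
    (hφ : MeasurePreserving φ unitVol unitVol) (hφa : ∀ t, ∃ n : ℤ, φ t = t + a + n) :
    HasSpec (g ∘ φ) Λ := by
  refine ⟨hg.1.comp_measurePreserving hφ, fun k hk => ?_⟩
  have h1 : ∀ t, expFun (-k) t * (g ∘ φ) t = expFun k a * (expFun (-k) (φ t) * g (φ t)) := by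
    intro t
    obtain ⟨n, hn⟩ := hφa t
    have h2 : expFun k a * expFun (-k) (φ t) = expFun (-k) t := by
      have h3 : expFun (-k) (n : ℝ) = 1 := by simpa using expFun_int_int (-k) n
      have h4 : expFun k a * expFun (-k) a = 1 := by
        rw [← expFun_add_left, add_neg_cancel, expFun_zero_left]
      rw [hn, expFun_add_right, expFun_add_right, h3]
      linear_combination expFun (-k) t * h4
    rw [← mul_assoc, h2]; rfl
  have h2 := hg.2 k hk
  unfold fcoeff at h2 ⊢
  simp_rw [h1]
  rw [integral_const_mul]
  have h3 : ∫ t, expFun (-k) (φ t) * g (φ t) ∂unitVol = ∫ t, expFun (-k) t * g t ∂unitVol := by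
    conv_rhs => rw [← hφ.map_eq]
    rw [integral_map hφ.aemeasurable]
    rw [hφ.map_eq]
    exact ((continuous_expFun _).aestronglyMeasurable).mul hg.1.1
  rw [h3, h2, mul_zero]

theorem mem_add_int_iff {E : Set ℝ} (hE : ∀ t, t + 1 ∈ E ↔ t ∈ E) (t : ℝ) (n : ℤ) :
    t + n ∈ E ↔ t ∈ E := by
  have hp : Function.Periodic (fun t => t ∈ E) (1 : ℝ) := fun t => propext (hE t)
  have := hp.int_mul n t
  rw [mul_one] at this
  exact iff_of_eq this

theorem RestrBij.translate {E : Set ℝ} {Λ : Set ℤ} (h : RestrBij E Λ)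
    (hE : ∀ t, t + 1 ∈ E ↔ t ∈ E) (a : ℝ) : RestrBij {t | t + a ∈ E} Λ := by
  obtain ⟨φ, hφ, hφa⟩ := exists_rotation a
  obtain ⟨ψ, hψ, hψa⟩ := exists_rotation (-a)
  have hφE : ∀ t, φ t ∈ E ↔ t + a ∈ E := fun t => by
    obtain ⟨n, hn⟩ := (hφa t).2
    rw [hn, mem_add_int_iff hE]
  have hψE : ∀ t, ψ t + a ∈ E ↔ t ∈ E := fun t => by
    obtain ⟨n, hn⟩ := (hψa t).2
    rw [hn, show t + -a + n + a = t + n by ring, mem_add_int_iff hE]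
  have hψφ : ∀ t ∈ Set.Ioc (0 : ℝ) 1, ψ (φ t) = t := fun t ht => by
    obtain ⟨n, hn⟩ := (hψa (φ t)).2
    obtain ⟨m, hm⟩ := (hφa t).2
    have h1 := (hψa (φ t)).1
    -- Both points lie in `(0, 1]` and differ by an integer, so they coincide.
    have h2 : ψ (φ t) - t = ((m + n : ℤ) : ℝ) := by rw [hn, hm]; push_cast; ring
    have h3 : |((m + n : ℤ) : ℝ)| < 1 := by
      rw [← h2, abs_lt]; constructor <;> linarith [h1.1, h1.2, ht.1, ht.2]
    have h4 : m + n = 0 := Int.abs_lt_one_iff.1 (by exact_mod_cast h3)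
    rw [h4] at h2; push_cast at h2; linarith
  refine ⟨fun g hg hg0 => ?_, fun u hu => ?_⟩
  · have h1 := h.1 (g ∘ ψ) (hg.comp_rotation hψ fun t => (hψa t).2) (by
      filter_upwards [hψ.quasiMeasurePreserving.ae hg0] with t ht htE
      exact ht ((hψE t).2 htE))
    filter_upwards [hφ.quasiMeasurePreserving.ae h1, ae_restrict_mem measurableSet_Ioc] with t ht htI
    rwa [Function.comp_apply, hψφ t htI] at ht
  · obtain ⟨g, hg, hgu⟩ := h.2 (u ∘ ψ) (hu.comp_measurePreserving hψ)
    refine ⟨g ∘ φ, hg.comp_rotation hφ fun t => (hφa t).2, ?_⟩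
    filter_upwards [hφ.quasiMeasurePreserving.ae hgu, ae_restrict_mem measurableSet_Ioc]
      with t ht htI htE
    rw [Function.comp_apply, ht ((hφE t).2 htE), Function.comp_apply, hψφ t htI]

theorem ae_lt_one : ∀ᵐ t ∂unitVol, t < 1 := by
  filter_upwards [ae_restrict_mem measurableSet_Ioc, ae_restrict_of_ae (Measure.ae_ne volume (1 : ℝ))]
    with t h1 h2 using lt_of_le_of_ne h1.2 h2

/-- Short arcs admit a Riesz basis of exponentials with integer frequencies. -/
theorem exists_restrBij_arc (p : ℝ) {θ : ℝ} (h0 : 0 < θ) (h1 : θ ≤ 1 / 4) :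
    ∃ Λ, RestrBij {t | Int.fract (t - p) < θ} Λ := by
  obtain ⟨Λ, hΛ⟩ := exists_restrBij_Ioc h0 h1
  refine ⟨Λ, ?_⟩
  have h2 : RestrBij {t | Int.fract t < θ} Λ := by
    refine hΛ.congr ?_
    filter_upwards [ae_lt_one, ae_restrict_mem measurableSet_Ioc,
      ae_restrict_of_ae (Measure.ae_ne volume θ)] with t h3 h4 h5
    rw [Int.fract_eq_self.2 ⟨h4.1.le, h3⟩]
    exact ⟨fun h => lt_of_le_of_ne h.2 h5, fun h => ⟨h4.1, h.le⟩⟩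
  have h3 := h2.translate (by simp) (-p)
  simpa [← sub_eq_add_neg] using h3

/-! ### Periodic step functions -/

open Filter Topology

/-- `G t` depends only on the integer parts of `t - p i`, `i ∈ D`. -/
def FloorDet {α : Type*} (D : Finset ℕ) (p : ℕ → ℝ) (G : ℝ → α) : Prop :=
  ∀ t t', (∀ i ∈ D, ⌊t - p i⌋ = ⌊t' - p i⌋) → G t = G t'

/-- The nodes `p i`, `i ∈ D`, are pairwise incongruent modulo one. -/
def Incongruent (D : Finset ℕ) (p : ℕ → ℝ) : Prop :=
  ∀ i ∈ D, ∀ j ∈ D, i ≠ j → ∀ k : ℤ, p i - p j ≠ k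

/-- The step function with jump `s i` at the points congruent to `p i`. -/
noncomputable def stepFun (D : Finset ℕ) (p : ℕ → ℝ) (s : ℕ → ℤ) (c : ℤ) (t : ℝ) : ℤ :=
  c + ∑ i ∈ D, s i * ⌊t - p i⌋

section floors
variable {α : Type*} {D : Finset ℕ} {p : ℕ → ℝ}

/-- Congruent nodes have floors that differ by a constant, so one of the two is redundant. -/
theorem FloorDet.erase {G : ℝ → α} (h : FloorDet D p G) {i j : ℕ} (hi : i ∈ D) (hij : i ≠ j) {k : ℤ}
    (hk : p i - p j = k) : FloorDet (D.erase j) p G := by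
  intro t t' ht
  refine h t t' fun l hl => ?_
  by_cases hlj : l = j
  · subst hlj
    have e : ∀ t : ℝ, t - p l = t - p i + k := fun t => by rw [← hk]; ring
    rw [e, e, Int.floor_add_intCast, Int.floor_add_intCast, ht i (Finset.mem_erase.2 ⟨hij, hi⟩)]
  · exact ht l (Finset.mem_erase.2 ⟨hlj, hl⟩)

theorem eventually_floor_left (D : Finset ℕ) (p : ℕ → ℝ) (t0 : ℝ) :
    ∀ᶠ t in 𝓝[<] t0, ∀ i ∈ D, ⌊t - p i⌋ = ⌈t0 - p i⌉ - 1 := by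
  rw [Finset.eventually_all]
  intro i _
  have h1 : Tendsto (fun t => t - p i) (𝓝[<] t0) (𝓝[<] (t0 - p i)) := by
    apply tendsto_nhdsWithin_of_tendsto_nhds_of_eventually_within
    · exact ((continuous_sub_right (p i)).tendsto t0).mono_left nhdsWithin_le_nhds
    · filter_upwards [self_mem_nhdsWithin] with t ht
      exact sub_lt_sub_right (Set.mem_Iio.1 ht) _
  have h2 := (tendsto_floor_left_pure_ceil_sub_one (t0 - p i)).comp h1
  exact tendsto_pure.1 h2

theorem eventually_floor_right (D : Finset ℕ) (p : ℕ → ℝ) (t0 : ℝ) :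
    ∀ᶠ t in 𝓝[≥] t0, ∀ i ∈ D, ⌊t - p i⌋ = ⌊t0 - p i⌋ := by
  rw [Finset.eventually_all]
  intro i _
  have h1 : Tendsto (fun t => t - p i) (𝓝[≥] t0) (𝓝[≥] (t0 - p i)) := by
    apply tendsto_nhdsWithin_of_tendsto_nhds_of_eventually_within
    · exact ((continuous_sub_right (p i)).tendsto t0).mono_left nhdsWithin_le_nhds
    · filter_upwards [self_mem_nhdsWithin] with t ht
      exact sub_le_sub_right (Set.mem_Ici.1 ht) _
  have h2 := (tendsto_floor_right_pure_floor (t0 - p i)).comp h1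
  exact tendsto_pure.1 h2

theorem ceil_sub_one_eq_floor {x : ℝ} (h : ∀ k : ℤ, x ≠ k) : ⌈x⌉ - 1 = ⌊x⌋ := by
  have h1 : ⌊x⌋ < ⌈x⌉ := by
    rw [Int.lt_ceil]; exact lt_of_le_of_ne (Int.floor_le x) (h _).symm
  have h2 := Int.ceil_le_floor_add_one x
  omega

/-- By incongruence only the node `i` has a floor that jumps at `p i + k`. -/
theorem sum_jump (hD : Incongruent D p) (s : ℕ → ℤ) {i : ℕ} (hi : i ∈ D) (k : ℤ) :
    ∑ j ∈ D, s j * (⌊p i + k - p j⌋ - (⌈p i + k - p j⌉ - 1)) = s i := by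
  rw [Finset.sum_eq_single_of_mem i hi]
  · have : p i + k - p i = (k : ℤ) := by ring
    rw [this]; simp
  · intro j hj hji
    rw [ceil_sub_one_eq_floor, sub_self, mul_zero]
    intro l hl
    exact hD i hi j hj hji.symm (l - k) (by push_cast; linarith)

/-- Periodic functions determined by integer parts are step functions. -/
theorem FloorDet.exists_stepFun {G : ℝ → ℤ} (h : FloorDet D p G) (hD : Incongruent D p)
    (hG : Function.Periodic G 1) : ∃ s c, (∀ t, G t = stepFun D p s c t) ∧ ∑ i ∈ D, s i = 0 := by
  -- A point just to the left of `t0`, at which every floor has its left limit.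
  have hleft : ∀ t0, ∃ l, ∀ i ∈ D, ⌊l - p i⌋ = ⌈t0 - p i⌉ - 1 :=
    fun t0 => (eventually_floor_left D p t0).exists
  choose l hl using hleft
  let s : ℕ → ℤ := fun i => G (p i) - G (l (p i))
  have hjump : ∀ t0, G t0 - G (l t0) = ∑ i ∈ D, s i * (⌊t0 - p i⌋ - (⌈t0 - p i⌉ - 1)) := by
    intro t0
    by_cases hc : ∃ i ∈ D, ∃ k : ℤ, t0 = p i + k
    · obtain ⟨i, hi, k, rfl⟩ := hc
      rw [sum_jump hD s hi]
      have h1 : G (p i + k) = G (p i) := by simpa using hG.int_mul k (p i)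
      have h2 : G (l (p i + k)) = G (l (p i)) := by
        have h3 : G (l (p i) + k) = G (l (p i)) := by simpa using hG.int_mul k (l (p i))
        rw [← h3]
        refine h _ _ fun j hj => ?_
        have e1 : l (p i) + k - p j = l (p i) - p j + k := by ring
        have e2 : p i + k - p j = p i - p j + k := by ring
        rw [e1, Int.floor_add_intCast, hl _ j hj, hl _ j hj, e2, Int.ceil_add_intCast]; ring
      rw [h1, h2]
    · push Not at hc
      have h1 : ∀ i ∈ D, ⌈t0 - p i⌉ - 1 = ⌊t0 - p i⌋ := fun i hi =>
        ceil_sub_one_eq_floor fun k hk => hc i hi k (by linarith)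
      rw [h (l t0) t0 fun i hi => by rw [hl _ i hi, h1 i hi], sub_self]
      exact (Finset.sum_eq_zero fun i hi => by rw [h1 i hi, sub_self, mul_zero]).symm
  -- With the jumps removed, the function is constant near every point from the left and from the
  -- right, hence constant on the line. Periodicity then forces the jumps to sum to zero.
  have hlc : IsLocallyConstant fun t => G t - ∑ i ∈ D, s i * ⌊t - p i⌋ := by
    rw [IsLocallyConstant.iff_eventually_eq]
    intro t0
    rw [← nhdsLT_sup_nhdsGE, eventually_sup]
    constructor
    · filter_upwards [eventually_floor_left D p t0] with t ht
      have h1 : G t = G (l t0) := h _ _ fun i hi => by rw [ht i hi, hl t0 i hi]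
      have h2 := hjump t0
      simp only [mul_sub, Finset.sum_sub_distrib] at h2
      have h3 : ∑ i ∈ D, s i * ⌊t - p i⌋ = ∑ i ∈ D, s i * (⌈t0 - p i⌉ - 1) :=
        Finset.sum_congr rfl fun i hi => by rw [ht i hi]
      rw [h1, h3]
      simp only [mul_sub, Finset.sum_sub_distrib]
      linarith
    · filter_upwards [eventually_floor_right D p t0] with t ht
      rw [h t t0 ht, Finset.sum_congr rfl fun i hi => by rw [ht i hi]]
  have hrep : ∀ t, G t = stepFun D p s (G 0 - ∑ i ∈ D, s i * ⌊0 - p i⌋) t := by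
    intro t
    have := hlc.apply_eq_of_preconnectedSpace t 0
    rw [stepFun]; linarith
  refine ⟨s, _, hrep, ?_⟩
  have h1 := hG 0
  rw [hrep, hrep] at h1
  simp only [stepFun] at h1
  have h2 : ∀ i ∈ D, s i * ⌊0 + 1 - p i⌋ = s i * ⌊0 - p i⌋ + s i := fun i _ => by
    have : (0 : ℝ) + 1 - p i = 0 - p i + 1 := by ring
    rw [this, Int.floor_add_one]; ring
  rw [Finset.sum_congr rfl h2, Finset.sum_add_distrib] at h1
  linarith

theorem stepFun_jump (hD : Incongruent D p) (s : ℕ → ℤ) (c : ℤ) {i : ℕ} (hi : i ∈ D) :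
    ∀ᶠ t in 𝓝[<] (p i), stepFun D p s c t = stepFun D p s c (p i) - s i := by
  filter_upwards [eventually_floor_left D p (p i)] with t ht
  have h1 := sum_jump hD s hi 0
  simp only [Int.cast_zero, add_zero, mul_sub, Finset.sum_sub_distrib] at h1
  rw [stepFun, stepFun, Finset.sum_congr rfl fun j hj => by rw [ht j hj]]
  simp only [mul_sub, Finset.sum_sub_distrib]
  linarith

theorem stepFun_floorDet (D : Finset ℕ) (p : ℕ → ℝ) (s : ℕ → ℤ) (c : ℤ) :
    FloorDet D p (stepFun D p s c) := fun t t' h => by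
  rw [stepFun, stepFun, Finset.sum_congr rfl fun i hi => by rw [h i hi]]

theorem stepFun_periodic {s : ℕ → ℤ} (hs : ∑ i ∈ D, s i = 0) (p : ℕ → ℝ) (c : ℤ) :
    Function.Periodic (stepFun D p s c) 1 := by
  intro t
  have h2 : ∀ i ∈ D, s i * ⌊t + 1 - p i⌋ = s i * ⌊t - p i⌋ + s i := fun i _ => by
    have : t + 1 - p i = t - p i + 1 := by ring
    rw [this, Int.floor_add_one]; ring
  rw [stepFun, stepFun, Finset.sum_congr rfl h2, Finset.sum_add_distrib, hs, add_zero]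

theorem measurable_stepFun (D : Finset ℕ) (p : ℕ → ℝ) (s : ℕ → ℤ) (c : ℤ) :
    Measurable (stepFun D p s c) := by
  unfold stepFun
  exact measurable_const.add (Finset.measurable_fun_sum _ fun i _ =>
    measurable_const.mul ((measurable_id.sub_const (p i)).floor))

theorem stepFun_erase {s : ℕ → ℤ} {i : ℕ} (hs : s i = 0) (c : ℤ) :
    stepFun D p s c = stepFun (D.erase i) p s c := by
  ext t
  rw [stepFun, stepFun, Finset.sum_erase]
  rw [hs, zero_mul]

/-- Hermite's identity. -/
theorem sum_floor_div {N : ℕ} (hN : 0 < N) (z : ℝ) : ∑ j ∈ Finset.range N, ⌊(z + j) / N⌋ = ⌊z⌋ := by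
  have hN' : (N : ℝ) ≠ 0 := by exact_mod_cast hN.ne'
  have hNp : (0 : ℝ) < N := by exact_mod_cast hN
  -- The difference of the two sides has period one and vanishes on `[0, 1)`.
  have hper : Function.Periodic (fun z : ℝ => ∑ j ∈ Finset.range N, ⌊(z + j) / N⌋ - ⌊z⌋) 1 := by
    intro z
    have h1 := Finset.sum_range_succ (fun j : ℕ => ⌊(z + j) / N⌋) N
    have h2 := Finset.sum_range_succ' (fun j : ℕ => ⌊(z + j) / N⌋) N
    have h3 : (z + (N : ℝ)) / N = (z + (0 : ℕ)) / N + 1 := by field_simp; push_cast; ring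
    rw [h3, Int.floor_add_one] at h1
    have h4 : ∑ j ∈ Finset.range N, ⌊(z + 1 + j) / N⌋ =
        ∑ j ∈ Finset.range N, ⌊(z + (j + 1 : ℕ)) / N⌋ :=
      Finset.sum_congr rfl fun j _ => by congr 2; push_cast; ring
    simp only
    rw [h4, Int.floor_add_one]
    linarith
  have h1 := hper.int_mul ⌊z⌋ (Int.fract z)
  rw [mul_one, Int.fract_add_floor] at h1
  have h2 : ∑ j ∈ Finset.range N, ⌊(Int.fract z + j) / N⌋ = 0 := by
    refine Finset.sum_eq_zero fun j hj => ?_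
    have hj' : (j : ℝ) + 1 ≤ N := by exact_mod_cast Finset.mem_range.1 hj
    rw [Int.floor_eq_zero_iff]
    refine ⟨div_nonneg (add_nonneg (Int.fract_nonneg z) (Nat.cast_nonneg j)) hNp.le, ?_⟩
    rw [div_lt_one hNp]; linarith [Int.fract_lt_one z]
  simp only [h2, Int.floor_fract] at h1
  linarith

end floors

/-! ### Folding a step function -/

section foldStep
variable {D : Finset ℕ} {p : ℕ → ℝ} {N : ℕ}

open scoped Classical in
/-- The integer-valued indicator function of a set. -/
noncomputable def intInd (E : Set ℝ) (t : ℝ) : ℤ := if t ∈ E then 1 else 0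

theorem intInd_eq_one {E : Set ℝ} {t : ℝ} : intInd E t = 1 ↔ t ∈ E := by simp [intInd]

theorem FloorDet.intInd {E : Set ℝ} (h : FloorDet D p (· ∈ E)) : FloorDet D p (intInd E) := by
  intro t t' ht
  have := h t t' ht
  classical exact if_congr (iff_of_eq this) rfl rfl

theorem floorDet_of_intInd {E : Set ℝ} (h : FloorDet D p (intInd E)) : FloorDet D p (· ∈ E) := by
  intro t t' ht
  have := h t t' ht
  exact propext (intInd_eq_one.symm.trans ((iff_of_eq (by rw [this])).trans intInd_eq_one))

theorem intInd_periodic {E : Set ℝ} (hE : ∀ t, t + 1 ∈ E ↔ t ∈ E) :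
    Function.Periodic (intInd E) 1 := fun t => by
  classical exact if_congr (hE t) rfl rfl

theorem card_foldIdx (E : Set ℝ) (y : ℝ) :
    ((foldIdx N E y).card : ℤ) = ∑ j ∈ Finset.range N, intInd E ((y + j) / N) := by
  classical
  simp only [intInd, Finset.sum_boole]
  congr

/-- Hermite's identity adds up the floors over the fibre: the nodes are multiplied by `N`, the jumps
do not change. -/
theorem card_foldIdx_eq_stepFun (hN : 0 < N) {E : Set ℝ} {s : ℕ → ℤ} {c : ℤ}
    (h : ∀ t, intInd E t = stepFun D p s c t) (y : ℝ) :
    ((foldIdx N E y).card : ℤ) = stepFun D (fun i => N * p i) s (N * c) y := by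
  have hN' : (N : ℝ) ≠ 0 := by exact_mod_cast hN.ne'
  rw [card_foldIdx]
  simp only [h, stepFun]
  rw [Finset.sum_add_distrib, Finset.sum_comm]
  congr 1
  · simp
  · refine Finset.sum_congr rfl fun i _ => ?_
    rw [← Finset.mul_sum, ← sum_floor_div hN]
    congr 1
    refine Finset.sum_congr rfl fun j _ => ?_
    congr 1; field_simp; ring

theorem measurableSet_of_intInd_eq {E : Set ℝ} {s : ℕ → ℤ} {c : ℤ}
    (h : ∀ t, intInd E t = stepFun D p s c t) : MeasurableSet E := by
  have : E = stepFun D p s c ⁻¹' {1} := by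
    ext t; rw [Set.mem_preimage, ← h, Set.mem_singleton_iff, intInd_eq_one]
  rw [this]
  exact measurable_stepFun D p s c (measurableSet_singleton 1)

theorem mem_foldLevel {E : Set ℝ} {n : ℕ} {y : ℝ} :
    y ∈ foldLevel N E n ↔ n < (foldIdx N E y).card := Iff.rfl

theorem exists_restrBij_fold {S : Set ℝ} (hS : MeasurableSet S) (hN : 0 < N)
    (h : ∀ n < N, ∃ Λ, RestrBij (foldLevel N S n) Λ) : ∃ Λ, RestrBij S Λ := by
  choose! Λ hΛ using h
  exact ⟨_, RestrBij.fold hS hN hΛ⟩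

end foldStep

/-! ### Mean squares of exponential sums -/

theorem tendsto_average_pow {w : ℂ} (hw : ‖w‖ = 1) (hw1 : w ≠ 1) :
    Tendsto (fun M : ℕ => (M : ℂ)⁻¹ * ∑ n ∈ Finset.range M, w ^ n) atTop (𝓝 0) := by
  have h0 : Tendsto (fun M : ℕ => (M : ℝ)⁻¹ * (2 / ‖w - 1‖)) atTop (𝓝 0) := by
    simpa using (tendsto_inv_atTop_nhds_zero_nat (𝕜 := ℝ)).mul_const (2 / ‖w - 1‖)
  refine squeeze_zero_norm (fun M => ?_) h0
  rw [norm_mul, norm_inv, Complex.norm_natCast]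
  gcongr
  rw [geom_sum_eq hw1, norm_div]
  gcongr
  refine (norm_sub_le _ _).trans ?_
  rw [norm_pow, hw]; norm_num

/-- The mean square of `∑ a i * z i ^ n` over `n` tends to `∑ ‖a i‖ ^ 2`. -/
theorem tendsto_average_norm_sq {D : Finset ℕ} {z a : ℕ → ℂ} (hz : ∀ i, ‖z i‖ = 1)
    (hne : ∀ i ∈ D, ∀ j ∈ D, i ≠ j → z i ≠ z j) :
    Tendsto (fun M : ℕ => (M : ℝ)⁻¹ * ∑ n ∈ Finset.range M, ‖∑ i ∈ D, a i * z i ^ n‖ ^ 2) atTop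
      (𝓝 (∑ i ∈ D, ‖a i‖ ^ 2)) := by
  have hpair : ∀ i ∈ D, ∀ j ∈ D, Tendsto (fun M : ℕ => (a i * starRingEnd ℂ (a j)) *
      ((M : ℂ)⁻¹ * ∑ n ∈ Finset.range M, (z i * starRingEnd ℂ (z j)) ^ n)) atTop
      (𝓝 (if i = j then ((‖a i‖ ^ 2 : ℝ) : ℂ) else 0)) := by
    intro i hi j hj
    have hc : ∀ w : ℂ, w * starRingEnd ℂ w = ((‖w‖ ^ 2 : ℝ) : ℂ) := fun w => by
      rw [Complex.mul_conj, Complex.normSq_eq_norm_sq]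
    split_ifs with hij
    · subst hij
      rw [hc, hc, hz]
      refine (tendsto_const_nhds (x := ((‖a i‖ ^ 2 : ℝ) : ℂ))).congr' ?_
      filter_upwards [eventually_gt_atTop 0] with M hM
      have : (M : ℂ) ≠ 0 := by exact_mod_cast hM.ne'
      simp [this]
    · have h1 : z i * starRingEnd ℂ (z j) ≠ 1 := by
        intro h
        apply hne i hi j hj hij
        have h2 : starRingEnd ℂ (z j) * z j = 1 := by rw [mul_comm, hc, hz]; simp
        linear_combination z j * h - z i * h2
      have h3 := (tendsto_average_pow (by simp [hz]) h1).const_mul (a i * starRingEnd ℂ (a j))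
      simpa using h3
  have hsum := tendsto_finsetSum D fun i hi => tendsto_finsetSum D fun j hj => hpair i hi j hj
  have hlim : ∑ i ∈ D, ∑ j ∈ D, (if i = j then ((‖a i‖ ^ 2 : ℝ) : ℂ) else 0) =
      ((∑ i ∈ D, ‖a i‖ ^ 2 : ℝ) : ℂ) := by
    rw [Complex.ofReal_sum]
    exact Finset.sum_congr rfl fun i hi => by simp [hi]
  rw [hlim] at hsum
  have hre := (Complex.continuous_re.tendsto _).comp hsum
  rw [Complex.ofReal_re] at hre
  refine hre.congr fun M => ?_
  have h1 : ∀ n, ((‖∑ i ∈ D, a i * z i ^ n‖ ^ 2 : ℝ) : ℂ) = ∑ i ∈ D, ∑ j ∈ D,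
      (a i * starRingEnd ℂ (a j)) * (z i * starRingEnd ℂ (z j)) ^ n := by
    intro n
    rw [← Complex.normSq_eq_norm_sq, ← Complex.mul_conj, map_sum, Finset.sum_mul_sum]
    refine Finset.sum_congr rfl fun i _ => Finset.sum_congr rfl fun j _ => ?_
    rw [map_mul, map_pow, mul_pow]; ring
  have h2 : (((M : ℝ)⁻¹ * ∑ n ∈ Finset.range M, ‖∑ i ∈ D, a i * z i ^ n‖ ^ 2 : ℝ) : ℂ) =
      ∑ i ∈ D, ∑ j ∈ D, (a i * starRingEnd ℂ (a j)) *
      ((M : ℂ)⁻¹ * ∑ n ∈ Finset.range M, (z i * starRingEnd ℂ (z j)) ^ n) := by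
    rw [Complex.ofReal_mul, Complex.ofReal_sum]
    simp only [h1]
    rw [Finset.sum_comm, Finset.mul_sum]
    refine Finset.sum_congr rfl fun i _ => ?_
    rw [Finset.sum_comm, Finset.mul_sum]
    refine Finset.sum_congr rfl fun j _ => ?_
    rw [← Finset.mul_sum, Complex.ofReal_inv, Complex.ofReal_natCast]; ring
  rw [Function.comp_apply, ← h2, Complex.ofReal_re]

section averaging
variable {D : Finset ℕ} {p : ℕ → ℝ} {s : ℕ → ℤ}

/-- The exponential sum of the jumps of a step function. -/
noncomputable def jumpSum (D : Finset ℕ) (p : ℕ → ℝ) (s : ℕ → ℤ) (k : ℤ) : ℂ :=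
  ∑ i ∈ D, s i * expFun (-k) (p i)

/-- As a function of `N`, the jump sum at the nodes `N p i` is `∑ s i * z i ^ N` with `z i = e_{-k}
(p i)`, and irrational distances make the `z i` distinct. The shift `n + 1` keeps `N` positive. -/
theorem tendsto_average_jumpSum (hp : ∀ i ∈ D, ∀ j ∈ D, i ≠ j → Irrational (p i - p j))
    (hs : ∀ i ∈ D, |s i| = 1) {k : ℤ} (hk : k ≠ 0) :
    Tendsto (fun M : ℕ => (M : ℝ)⁻¹ * ∑ n ∈ Finset.range M,
      ‖jumpSum D (fun i => ((n + 1 : ℕ) : ℝ) * p i) s k‖ ^ 2) atTop (𝓝 (D.card : ℝ)) := by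
  have h := tendsto_average_norm_sq (D := D) (z := fun i => expFun (-k) (p i))
    (a := fun i => s i * expFun (-k) (p i)) (fun i => norm_expFun _ _) (by
      intro i hi j hj hij h
      have h1 : expFun (-k) (p i - p j) = 1 := by
        have h2 : expFun (-k) (p i - p j) * expFun (-k) (p j) = 1 * expFun (-k) (p j) := by
          rw [← expFun_add_right, sub_add_cancel, h, one_mul]
        exact mul_right_cancel₀ (expFun_ne_zero _ _) h2
      obtain ⟨n, hn⟩ := (expFun_eq_one_iff _ _).1 h1
      have h3 : Irrational (((-k : ℤ) : ℝ) * (p i - p j)) :=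
        (hp i hi j hj hij).intCast_mul (neg_ne_zero.2 hk)
      apply h3.ne_int n
      push_cast; exact hn)
  have h1 : ∑ i ∈ D, ‖(s i : ℂ) * expFun (-k) (p i)‖ ^ 2 = (D.card : ℝ) := by
    have : ∀ i ∈ D, ‖(s i : ℂ) * expFun (-k) (p i)‖ ^ 2 = 1 := fun i hi => by
      rw [norm_mul, norm_expFun, mul_one, Complex.norm_intCast, ← Int.cast_abs, hs i hi]; simp
    rw [Finset.sum_congr rfl this]; simp
  rw [h1] at h
  refine h.congr fun M => ?_
  congr 1
  refine Finset.sum_congr rfl fun n _ => ?_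
  congr 2
  refine Finset.sum_congr rfl fun i _ => ?_
  rw [expFun_pow, mul_assoc, ← expFun_congr (a := n * -k) (s := p i) rfl]
  congr 1
  have : expFun (-k) (((n + 1 : ℕ) : ℝ) * p i) = expFun (-k + n * -k) (p i) :=
    expFun_congr (by push_cast; ring)
  rw [this, expFun_add_left]

/-- The mean over `N` of the right-hand side tends to `(1 + 1 / 4) * D.card ≥ 5`, which exceeds `π ^
2 / 2 < 4.94`. The second frequency is needed: the first alone gives only `4`. -/
theorem exists_large_jumpSum (hp : ∀ i ∈ D, ∀ j ∈ D, i ≠ j → Irrational (p i - p j))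
    (hs : ∀ i ∈ D, |s i| = 1) (hD : 4 ≤ D.card) : ∃ N : ℕ, 0 < N ∧
      Real.pi ^ 2 / 2 < ‖jumpSum D (fun i => N * p i) s 1‖ ^ 2 +
        ‖jumpSum D (fun i => N * p i) s 2‖ ^ 2 / 4 := by
  by_contra! hcon
  have h1 := tendsto_average_jumpSum hp hs one_ne_zero
  have h2 := (tendsto_average_jumpSum hp hs two_ne_zero).div_const 4
  have h3 := le_of_tendsto (h1.add h2) (b := Real.pi ^ 2 / 2) (by
    filter_upwards [eventually_gt_atTop 0] with M hM
    have hM' : (0 : ℝ) < M := by exact_mod_cast hM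
    rw [mul_div_assoc, ← mul_add, inv_mul_le_iff₀ hM', Finset.sum_div, ← Finset.sum_add_distrib]
    refine (Finset.sum_le_card_nsmul _ _ (Real.pi ^ 2 / 2) fun n _ => hcon (n + 1) n.succ_pos).trans ?_
    simp)
  have h4 : (4 : ℝ) ≤ D.card := by exact_mod_cast hD
  nlinarith [Real.pi_lt_d2, Real.pi_pos]

end averaging

/-! ### Fourier coefficients of step functions -/

theorem fcoeff_const (c : ℂ) {k : ℤ} (hk : k ≠ 0) : fcoeff (fun _ => c) k = 0 := by
  have hm : MemLp (fun t => c * expFun (0 : ℤ) t) 2 unitVol := memLp_of_continuous (by fun_prop)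
  have h1 : hm.toLp _ = c • expBasis 0 := by
    apply Lp.ext
    filter_upwards [hm.coeFn_toLp, Lp.coeFn_smul c (expBasis 0), coeFn_expBasis 0] with t h1 h2 h3
    rw [h1, h2, Pi.smul_apply, h3, smul_eq_mul]
  have h2 := expBasis_repr_toLp hm k
  rw [h1, map_smul, lp.coeFn_smul, Pi.smul_apply, HilbertBasis.repr_apply_apply,
    expBasis.orthonormal.inner_eq_zero hk, smul_zero] at h2
  rw [h2]
  exact fcoeff_congr (Filter.Eventually.of_forall fun t => by simp [expFun_zero_left]) k

theorem memLp_of_bounded {f : ℝ → ℝ} (hf : Measurable f) {C : ℝ} (hC : ∀ t, |f t| ≤ C) :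
    MemLp (fun t => (f t : ℂ)) 2 unitVol :=
  MemLp.of_bound (Complex.measurable_ofReal.comp hf).aestronglyMeasurable C
    (Filter.Eventually.of_forall fun t => by simpa using hC t)

theorem fcoeff_id {k : ℤ} (hk : k ≠ 0) :
    fcoeff (fun t => (t : ℂ)) k = Complex.I / (2 * Real.pi * k) := by
  have hk' : (k : ℂ) ≠ 0 := by exact_mod_cast hk
  have hpi : (Real.pi : ℂ) ≠ 0 := by exact_mod_cast Real.pi_ne_zero
  have hI := Complex.I_sq
  let a : ℂ := 2 * Real.pi * Complex.I * (-k : ℝ)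
  have ha : a ≠ 0 := by simp [a, hk', hpi]
  have hd : ∀ t ∈ Set.uIcc (0 : ℝ) 1, HasDerivAt
      (fun t : ℝ => (t : ℂ) * expFun (-k) t / a - expFun (-k) t / a ^ 2)
      (expFun (-k) t * t) t := by
    intro t _
    have h1 : HasDerivAt (fun s : ℝ => a * (s : ℂ)) (a * 1) t :=
      (hasDerivAt_id t).ofReal_comp.const_mul _
    have h2 : HasDerivAt (expFun (-k)) (expFun (-k) t * (a * 1)) t := by
      have := h1.cexp
      unfold expFun
      exact this
    have h3 := ((((hasDerivAt_id t).ofReal_comp).mul h2).div_const a).sub (h2.div_const (a ^ 2))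
    refine h3.congr_deriv ?_
    simp only [id_eq, Complex.ofReal_one]
    field_simp
    ring
  rw [fcoeff, unitVol, ← intervalIntegral.integral_of_le zero_le_one,
    intervalIntegral.integral_eq_sub_of_hasDerivAt hd
      (Continuous.intervalIntegrable (by fun_prop) _ _)]
  have e1 : expFun (-k) (1 : ℝ) = 1 := by simpa using expFun_int_int (-k) 1
  have e2 : Complex.I / (2 * Real.pi * k) = 1 / a := by
    rw [div_eq_div_iff (by simp [hk', hpi]) ha]
    simp only [a]
    push_cast
    linear_combination (-2 * Real.pi * k : ℂ) * hI
  rw [e1, expFun_zero_right, e2]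
  push_cast
  ring

theorem fcoeff_fract (q : ℝ) {k : ℤ} (hk : k ≠ 0) :
    fcoeff (fun t => ((Int.fract (t - q) : ℝ) : ℂ)) k = expFun (-k) q * (Complex.I / (2 * Real.pi * k)) := by
  have h0 : fcoeff (fun t => ((Int.fract t : ℝ) : ℂ)) k = Complex.I / (2 * Real.pi * k) := by
    rw [← fcoeff_id hk]
    apply fcoeff_congr
    filter_upwards [ae_lt_one, ae_restrict_mem measurableSet_Ioc] with t h3 h4
    rw [Int.fract_eq_self.2 ⟨h4.1.le, h3⟩]
  rw [← h0]
  simp only [fcoeff, unitVol, ← intervalIntegral.integral_of_le zero_le_one]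
  have hper : Function.Periodic (fun t : ℝ => expFun (-k) t * ((Int.fract t : ℝ) : ℂ)) 1 := by
    intro t
    have e1 : expFun (-k) (1 : ℝ) = 1 := by simpa using expFun_int_int (-k) 1
    simp only
    rw [expFun_add_right, e1, mul_one, Int.fract_add_one]
  have h1 := hper.intervalIntegral_add_eq (-q) 0
  rw [zero_add] at h1
  rw [← h1, ← intervalIntegral.integral_const_mul]
  have h2 := intervalIntegral.integral_comp_sub_right (a := 0) (b := 1)
    (fun t : ℝ => expFun (-k) q * (expFun (-k) t * ((Int.fract t : ℝ) : ℂ))) q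
  rw [zero_sub, show (1 : ℝ) - q = -q + 1 by ring] at h2
  rw [← h2]
  apply intervalIntegral.integral_congr
  intro t _
  simp only
  rw [← mul_assoc, ← expFun_add_right, add_sub_cancel]

/-- Since the jumps sum to zero, replacing each floor by its argument minus the fractional part
cancels the linear term, leaving a constant minus `∑ s i * fract (t - p i)`. -/
theorem fcoeff_stepFun {D : Finset ℕ} {p : ℕ → ℝ} {s : ℕ → ℤ} (hs : ∑ i ∈ D, s i = 0) (c : ℤ)
    {k : ℤ} (hk : k ≠ 0) : fcoeff (fun t => (stepFun D p s c t : ℂ)) k =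
      -(jumpSum D p s k * (Complex.I / (2 * Real.pi * k))) := by
  have hint : ∀ i, Integrable (fun t => expFun (-k) t * ((Int.fract (t - p i) : ℝ) : ℂ)) unitVol := by
    intro i
    have hm : MemLp (fun t => ((Int.fract (t - p i) : ℝ) : ℂ)) 2 unitVol :=
      memLp_of_bounded (C := 1) (measurable_id.sub_const (p i)).fract fun t => by
        rw [abs_of_nonneg (Int.fract_nonneg _)]; exact (Int.fract_lt_one _).le
    exact (hm.expFun_mul (-k) (φ := fun t => t) (by fun_prop)).integrable (by norm_num)
  let C : ℂ := c - ∑ i ∈ D, s i * p i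
  have hC : Integrable (fun t => expFun (-k) t * C) unitVol :=
    (memLp_of_continuous (by fun_prop)).integrable (by norm_num)
  have hdec : ∀ t, expFun (-k) t * (stepFun D p s c t : ℂ) = expFun (-k) t * C -
      ∑ i ∈ D, s i * (expFun (-k) t * ((Int.fract (t - p i) : ℝ) : ℂ)) := by
    intro t
    have h1 : ∀ i ∈ D, (s i : ℂ) * (expFun (-k) t * ((Int.fract (t - p i) : ℝ) : ℂ)) =
        expFun (-k) t * (s i * (t : ℂ) - s i * p i - s i * ⌊t - p i⌋) := by
      intro i _
      rw [← Int.self_sub_floor]; push_cast; ring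
    rw [Finset.sum_congr rfl h1, ← Finset.mul_sum, ← mul_sub, stepFun]
    congr 1
    simp only [C, Finset.sum_sub_distrib, ← Finset.sum_mul]
    have h2 : ∑ i ∈ D, (s i : ℂ) = 0 := by exact_mod_cast hs
    rw [h2]; push_cast; ring
  have h3 : ∫ t, expFun (-k) t * C ∂unitVol = 0 := fcoeff_const C hk
  unfold fcoeff
  simp_rw [hdec]
  rw [integral_sub hC (integrable_finsetSum _ fun i _ => (hint i).const_mul _), h3,
    integral_finsetSum _ (fun i _ => (hint i).const_mul _), zero_sub, jumpSum, Finset.sum_mul]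
  congr 1
  refine Finset.sum_congr rfl fun i _ => ?_
  have h4 := fcoeff_fract (p i) hk
  unfold fcoeff at h4
  rw [integral_const_mul, h4]
  ring

theorem norm_fcoeff_stepFun {D : Finset ℕ} {p : ℕ → ℝ} {s : ℕ → ℤ} (hs : ∑ i ∈ D, s i = 0) (c : ℤ)
    {k : ℤ} (hk : k ≠ 0) : ‖fcoeff (fun t => (stepFun D p s c t : ℂ)) k‖ ^ 2 =
      ‖jumpSum D p s k‖ ^ 2 / (4 * Real.pi ^ 2 * (k : ℝ) ^ 2) := by
  rw [fcoeff_stepFun hs c hk]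
  simp only [norm_neg, norm_mul, norm_div, Complex.norm_I, Complex.norm_real, Complex.norm_intCast,
    Real.norm_eq_abs, mul_pow, div_pow, sq_abs]
  norm_num
  ring

theorem norm_jumpSum_neg (D : Finset ℕ) (p : ℕ → ℝ) (s : ℕ → ℤ) (k : ℤ) :
    ‖jumpSum D p s (-k)‖ = ‖jumpSum D p s k‖ := by
  rw [← Complex.norm_conj]
  congr 1
  simp only [jumpSum, map_sum, map_mul, conj_expFun]
  refine Finset.sum_congr rfl fun i _ => ?_
  simp

/-- The first Fourier coefficients of a set are small. -/
theorem jumpSum_le_of_intInd {D : Finset ℕ} {p : ℕ → ℝ} {s : ℕ → ℤ} (hs : ∑ i ∈ D, s i = 0) {c n : ℤ}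
    {A : Set ℝ} (hA : MeasurableSet A) (h : ∀ t, stepFun D p s c t = n + intInd A t) :
    ‖jumpSum D p s 1‖ ^ 2 + ‖jumpSum D p s 2‖ ^ 2 / 4 ≤ Real.pi ^ 2 / 2 := by
  classical
  let f : ℝ → ℂ := A.indicator 1
  have hf : MemLp f 2 unitVol := (memLp_const (1 : ℂ)).indicator hA
  have hfi : ∀ t, f t = (stepFun D p s (c - n) t : ℂ) := by
    intro t
    have h1 : stepFun D p s (c - n) t = intInd A t := by
      have := h t; simp only [stepFun] at this ⊢; linarith
    rw [h1]; simp [f, intInd, Set.indicator_apply]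
  -- Bessel's inequality at the frequencies `0, ±1, ±2`. With `a` the measure of `A`, the nonzero
  -- ones contribute at most `a - a ^ 2 ≤ 1 / 4`.
  have hb := expBasis.orthonormal.sum_inner_products_le (s := {0, 1, -1, 2, -2}) (hf.toLp f)
  simp only [← HilbertBasis.repr_apply_apply, expBasis_repr_toLp hf] at hb
  have hk : ∀ k : ℤ, k ≠ 0 → ‖fcoeff f k‖ ^ 2 =
      ‖jumpSum D p s k‖ ^ 2 / (4 * Real.pi ^ 2 * (k : ℝ) ^ 2) := by
    intro k hk
    rw [← norm_fcoeff_stepFun hs (c - n) hk]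
    congr 3; ext t; exact hfi t
  have hn : ‖hf.toLp f‖ ^ 2 = unitVol.real A := by
    rw [norm_toLp_sq]
    have : ∀ t, ‖f t‖ ^ 2 = A.indicator 1 t := fun t => by
      by_cases ht : t ∈ A <;> simp [f, ht]
    simp_rw [this]
    exact integral_indicator_one hA
  have h0 : ‖fcoeff f 0‖ ^ 2 = unitVol.real A ^ 2 := by
    have : fcoeff f 0 = (unitVol.real A : ℂ) := by
      simp only [fcoeff, Int.cast_zero, neg_zero, expFun_zero_left, one_mul, f]
      rw [integral_indicator hA]; simp [Measure.real]
    rw [this, Complex.norm_real, Real.norm_eq_abs, sq_abs]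
  rw [hn] at hb
  rw [Finset.sum_insert (by decide), Finset.sum_insert (by decide), Finset.sum_insert (by decide),
    Finset.sum_insert (by decide), Finset.sum_singleton, h0, hk 1 (by decide), hk (-1) (by decide),
    hk 2 (by decide), hk (-2) (by decide), norm_jumpSum_neg, norm_jumpSum_neg] at hb
  set a := unitVol.real A
  set x := ‖jumpSum D p s 1‖ ^ 2
  set y := ‖jumpSum D p s 2‖ ^ 2
  have hpi := Real.pi_pos
  have h1 : (x + y / 4) / (2 * Real.pi ^ 2) ≤ 1 / 4 := by
    have h2 : x / (4 * Real.pi ^ 2 * ((1 : ℤ) : ℝ) ^ 2) + (x / (4 * Real.pi ^ 2 * ((-1 : ℤ) : ℝ) ^ 2) +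
        (y / (4 * Real.pi ^ 2 * ((2 : ℤ) : ℝ) ^ 2) + y / (4 * Real.pi ^ 2 * ((-2 : ℤ) : ℝ) ^ 2))) =
        (x + y / 4) / (2 * Real.pi ^ 2) := by
      push_cast; field_simp; ring
    nlinarith [sq_nonneg (a - 1 / 2)]
  rw [div_le_iff₀ (by positivity)] at h1
  linarith

/-- If a level set of an integer step function with unit jumps has a jump at every node, then the
function takes only two values. -/
theorem stepFun_eq_add_intInd {D : Finset ℕ} {p : ℕ → ℝ} {s σ : ℕ → ℤ} {c c' n : ℤ} {A : Set ℝ}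
    (hD : Incongruent D p) (hne : D.Nonempty) (hs0 : ∑ i ∈ D, s i = 0) (hs : ∀ i ∈ D, |s i| = 1)
    (hA : ∀ t, t ∈ A ↔ n < stepFun D p s c t) (hσ : ∀ t, intInd A t = stepFun D p σ c' t)
    (hσ0 : ∀ i ∈ D, σ i ≠ 0) (t : ℝ) : stepFun D p s c t = n + intInd A t := by
  have hval : ∀ t, (n < stepFun D p s c t ∧ intInd A t = 1) ∨
      (stepFun D p s c t ≤ n ∧ intInd A t = 0) := by
    intro t
    by_cases ht : t ∈ A
    · exact Or.inl ⟨(hA t).1 ht, by simp [intInd, ht]⟩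
    · exact Or.inr ⟨not_lt.1 fun h => ht ((hA t).2 h), by simp [intInd, ht]⟩
  -- A unit jump that also changes membership in the level set must cross between `n` and `n + 1`.
  have hnode : ∀ i ∈ D, stepFun D p s c (p i) = n ∨ stepFun D p s c (p i) = n + 1 := by
    intro i hi
    obtain ⟨r, h1, h2⟩ := ((stepFun_jump hD s c hi).and (stepFun_jump hD σ c' hi)).exists
    rw [← hσ, ← hσ] at h2
    have h3 := hσ0 i hi
    have h4 := hs i hi
    have h5 := hval r
    have h6 := hval (p i)
    rcases abs_eq (zero_le_one) |>.1 h4 with h | h <;> omega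
  -- The last node, modulo one, at or before `t`: no floor changes between it and `t`.
  obtain ⟨i, hi, hmin⟩ := D.exists_min_image (fun i => Int.fract (t - p i)) hne
  have h1 : stepFun D p s c t = stepFun D p s c (p i) := by
    have h2 : stepFun D p s c (p i + ⌊t - p i⌋) = stepFun D p s c (p i) := by
      simpa using (stepFun_periodic hs0 p c).int_mul ⌊t - p i⌋ (p i)
    rw [← h2]
    refine stepFun_floorDet D p s c _ _ fun j hj => ?_
    have h3 : p i + ⌊t - p i⌋ - p j = t - p j - Int.fract (t - p i) := by
      rw [← Int.self_sub_floor]; ring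
    rw [h3, eq_comm, Int.floor_eq_iff]
    have h4 := hmin j hj
    have h5 := Int.fract_nonneg (t - p i)
    have h6 := Int.self_sub_floor (t - p j)
    have h7 := Int.fract_lt_one (t - p j)
    constructor <;> linarith
  have h8 := hnode i hi
  have h9 := hval t
  omega

/-! ### Induction on the number of nodes -/

/-- Dirichlet's theorem gives a multiple `K α` within `1 / 5` of an integer. If it lies above, it
serves. If it lies below by `y`, then `⌊1 / y⌋` steps of length `y` go almost once around the circle
and stop less than `y` above an integer. -/
theorem exists_nat_mul_fract_le {α : ℝ} (hα : Irrational α) :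
    ∃ N : ℕ, 0 < N ∧ 0 < Int.fract (N * α) ∧ Int.fract (N * α) ≤ 1 / 4 := by
  have hirr : ∀ N : ℕ, 0 < N → ∀ k : ℤ, (N : ℝ) * α ≠ k := fun N hN k =>
    (hα.natCast_mul hN.ne').ne_int k
  have hpos : ∀ N : ℕ, 0 < N → 0 < Int.fract (N * α) := fun N hN =>
    lt_of_le_of_ne (Int.fract_nonneg _) fun h => by
      have h2 := Int.self_sub_floor ((N : ℝ) * α)
      exact hirr N hN ⌊(N : ℝ) * α⌋ (by linarith)
  obtain ⟨j, k, hk0, -, hjk⟩ := Real.exists_int_int_abs_mul_sub_le α (n := 4) (by norm_num)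
  obtain ⟨K, rfl⟩ := Int.eq_ofNat_of_zero_le hk0.le
  have hK : 0 < K := by exact_mod_cast hk0
  set x : ℝ := (K : ℝ) * α - j with hx
  have hx4 : |x| ≤ 1 / 4 := by
    have : |x| ≤ 1 / ((4 : ℕ) + 1 : ℝ) := by simpa [hx, mul_comm] using hjk
    refine this.trans (by norm_num)
  have hx0 : x ≠ 0 := sub_ne_zero.2 (hirr K hK j)
  rcases lt_or_gt_of_ne hx0 with hneg | hp
  · have hy : 0 < -x := by linarith
    have hy4 : -x ≤ 1 / 4 := by linarith [neg_abs_le x]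
    let M := ⌊(-x)⁻¹⌋₊
    have hM1 : (M : ℝ) * -x ≤ 1 := by
      have := Nat.floor_le (inv_nonneg.2 hy.le)
      calc (M : ℝ) * -x ≤ (-x)⁻¹ * -x := by gcongr
        _ = 1 := inv_mul_cancel₀ hy.ne'
    have hM2 : 1 < ((M : ℝ) + 1) * -x := by
      have := Nat.lt_floor_add_one (-x)⁻¹
      calc 1 = (-x)⁻¹ * -x := (inv_mul_cancel₀ hy.ne').symm
        _ < ((M : ℝ) + 1) * -x := by gcongr
    have hM0 : 0 < M := by
      rcases Nat.eq_zero_or_pos M with h | h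
      · rw [h] at hM2; norm_num at hM2; linarith
      · exact h
    refine ⟨M * K, Nat.mul_pos hM0 hK, hpos _ (Nat.mul_pos hM0 hK), ?_⟩
    have e : ((M * K : ℕ) : ℝ) * α = (1 - (M : ℝ) * -x) + ((M * j - 1 : ℤ) : ℝ) := by
      push_cast; rw [hx]; ring
    rw [e, Int.fract_add_intCast, Int.fract_eq_self.2]
    · linarith
    · constructor <;> linarith
  · refine ⟨K, hK, hpos K hK, ?_⟩
    have e : (K : ℝ) * α = x + j := by rw [hx]; ring
    have := le_abs_self x
    rw [e, Int.fract_add_intCast, Int.fract_eq_self.2]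
    · linarith
    · constructor <;> linarith

theorem floor_sub_floor_arc (v θ : ℝ) (h0 : 0 < θ) (h1 : θ < 1) :
    ⌊v⌋ - ⌊v - θ⌋ = if Int.fract v < θ then 1 else 0 := by
  have h2 := Int.fract_nonneg v
  have h3 := Int.fract_lt_one v
  have h4 := Int.self_sub_floor v
  split_ifs with h
  · have : ⌊v - θ⌋ = ⌊v⌋ - 1 := by
      rw [Int.floor_eq_iff]; push_cast; constructor <;> linarith
    rw [this]; ring
  · have : ⌊v - θ⌋ = ⌊v⌋ := by
      rw [Int.floor_eq_iff]; constructor <;> linarith [not_lt.1 h]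
    rw [this]; ring

/-- Level sets of step functions with two opposite jumps at a short distance. -/
theorem exists_restrBij_two_nodes {q q' : ℝ} (h0 : 0 < Int.fract (q' - q))
    (h1 : Int.fract (q' - q) ≤ 1 / 4) (c n : ℤ) :
    ∃ Λ, RestrBij {t | n < c + (⌊t - q⌋ - ⌊t - q'⌋)} Λ := by
  set θ := Int.fract (q' - q)
  set k := ⌊q' - q⌋
  have hq : q' = q + θ + k := by
    have := Int.floor_add_fract (q' - q)
    simp only [θ, k]; linarith
  have h2 : ∀ t : ℝ, ⌊t - q⌋ - ⌊t - q'⌋ = (if Int.fract (t - q) < θ then 1 else 0) + k := by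
    intro t
    have e : t - q' = t - q - θ - k := by rw [hq]; ring
    rw [e, Int.floor_sub_intCast, ← floor_sub_floor_arc (t - q) θ h0 (by linarith)]
    ring
  rcases lt_trichotomy n (c + k) with h | h | h
  · refine ⟨_, restrBij_univ (Eventually.of_forall fun t => ?_)⟩
    change n < c + (⌊t - q⌋ - ⌊t - q'⌋)
    rw [h2]; split_ifs <;> omega
  · obtain ⟨Λ, hΛ⟩ := exists_restrBij_arc q h0 h1
    refine ⟨Λ, hΛ.congr (Eventually.of_forall fun t => ?_)⟩
    change Int.fract (t - q) < θ ↔ n < c + (⌊t - q⌋ - ⌊t - q'⌋)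
    rw [h2]; split_ifs with hh <;> simp only [hh, true_iff, false_iff] <;> omega
  · refine ⟨_, restrBij_empty (Eventually.of_forall fun t => ?_)⟩
    change ¬ n < c + (⌊t - q⌋ - ⌊t - q'⌋)
    rw [h2]; split_ifs <;> omega

/-- Periodic sets with finitely many jumps admit a Riesz basis of exponentials with integer
frequencies. -/
theorem exists_restrBij_of_floorDet (d : ℕ) : ∀ (D : Finset ℕ) (p : ℕ → ℝ) (E : Set ℝ), D.card = d →
    (∀ t, t + 1 ∈ E ↔ t ∈ E) → FloorDet D p (· ∈ E) → ∃ Λ, RestrBij E Λ := by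
  induction d using Nat.strong_induction_on with
  | _ d ih =>
  intro D p E hd hE hdet
  -- Congruent nodes and nodes without a jump are discarded first; the jumps that remain are `±1`,
  -- being those of an indicator.
  by_cases hinc : Incongruent D p
  swap
  · unfold Incongruent at hinc
    push Not at hinc
    obtain ⟨i, hi, j, hj, hij, k, hk⟩ := hinc
    exact ih _ (by rw [← hd]; exact Finset.card_erase_lt_of_mem hj) _ p E rfl hE
      (hdet.erase hi hij hk)
  obtain ⟨s, c, hrep, hs0⟩ := hdet.intInd.exists_stepFun hinc (intInd_periodic hE)
  by_cases hz : ∃ i ∈ D, s i = 0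
  · obtain ⟨i, hi, hsi⟩ := hz
    refine ih _ (by rw [← hd]; exact Finset.card_erase_lt_of_mem hi) (D.erase i) p E rfl hE ?_
    apply floorDet_of_intInd
    have : intInd E = stepFun (D.erase i) p s c := by
      rw [← stepFun_erase hsi]; exact funext hrep
    rw [this]; exact stepFun_floorDet _ _ _ _
  push Not at hz
  have hs : ∀ i ∈ D, |s i| = 1 := by
    intro i hi
    obtain ⟨r, h1⟩ := (stepFun_jump hinc s c hi).exists
    rw [← hrep, ← hrep] at h1
    have h2 := hz i hi
    have h3 : ∀ t, intInd E t = 0 ∨ intInd E t = 1 := fun t => by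
      by_cases ht : t ∈ E <;> simp [intInd, ht]
    rw [abs_eq zero_le_one]
    rcases h3 r with h | h <;> rcases h3 (p i) with h' | h' <;> omega
  have hmeas : MeasurableSet E := measurableSet_of_intInd_eq hrep
  have hlev : ∀ N : ℕ, 0 < N → ∀ n : ℕ, ∀ t, t ∈ foldLevel N E n ↔
      (n : ℤ) < stepFun D (fun i => N * p i) s (N * c) t := by
    intro N hN n t
    rw [← card_foldIdx_eq_stepFun hN hrep, mem_foldLevel]; exact_mod_cast Iff.rfl
  have hlevper : ∀ N : ℕ, 0 < N → ∀ n : ℕ, ∀ t, t + 1 ∈ foldLevel N E n ↔ t ∈ foldLevel N E n := by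
    intro N hN n t
    rw [hlev N hN, hlev N hN, stepFun_periodic hs0]
  have hlevdet : ∀ N : ℕ, 0 < N → ∀ n : ℕ,
      FloorDet D (fun i => N * p i) (· ∈ foldLevel N E n) := by
    intro N hN n t t' h
    refine propext ?_
    change t ∈ foldLevel N E n ↔ t' ∈ foldLevel N E n
    rw [hlev N hN, hlev N hN, stepFun_floorDet _ _ _ _ t t' h]
  -- Folding by the denominator of a rational distance makes the two nodes congruent, so every level
  -- set has fewer nodes.
  by_cases hrat : ∃ i ∈ D, ∃ j ∈ D, i ≠ j ∧ ¬ Irrational (p i - p j)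
  · obtain ⟨i, hi, j, hj, hij, hr⟩ := hrat
    rw [Irrational, not_not] at hr
    obtain ⟨r, hr⟩ := hr
    refine exists_restrBij_fold hmeas r.den_pos fun n _ => ?_
    refine ih _ (by rw [← hd]; exact Finset.card_erase_lt_of_mem hj) (D.erase j) _ _ rfl
      (hlevper _ r.den_pos n) ((hlevdet _ r.den_pos n).erase hi hij (k := r.num) ?_)
    rw [← mul_sub, ← hr]
    have := Rat.den_mul_eq_num r
    exact_mod_cast this
  push Not at hrat
  rcases D.eq_empty_or_nonempty with hDe | hDne
  · subst hDe
    by_cases h0 : (0 : ℝ) ∈ E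
    · refine ⟨_, restrBij_univ (Eventually.of_forall fun t => ?_)⟩
      exact (iff_of_eq (hdet t 0 (by simp))).2 h0
    · refine ⟨_, restrBij_empty (Eventually.of_forall fun t => ?_)⟩
      exact fun h => h0 ((iff_of_eq (hdet t 0 (by simp))).1 h)
  -- With this `N` the sheet count is not two-valued, so each level set fails to jump at some node
  -- and the induction hypothesis applies to it.
  by_cases hcard : 4 ≤ D.card
  · obtain ⟨N, hN, hlarge⟩ := exists_large_jumpSum hrat hs hcard
    have hincN : Incongruent D fun i => N * p i := by
      intro i hi j hj hij k hk
      rw [← mul_sub] at hk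
      exact ((hrat i hi j hj hij).natCast_mul hN.ne').ne_int k hk
    refine exists_restrBij_fold hmeas hN fun n _ => ?_
    obtain ⟨σ, c', hσ, -⟩ := (hlevdet N hN n).intInd.exists_stepFun hincN
      (intInd_periodic (hlevper N hN n))
    by_cases hσz : ∃ i ∈ D, σ i = 0
    · obtain ⟨i, hi, hsi⟩ := hσz
      refine ih _ (by rw [← hd]; exact Finset.card_erase_lt_of_mem hi) (D.erase i)
        (fun i => N * p i) _ rfl (hlevper N hN n) ?_
      apply floorDet_of_intInd
      have : intInd (foldLevel N E n) = stepFun (D.erase i) (fun i => N * p i) σ c' := by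
        rw [← stepFun_erase hsi]; exact funext hσ
      rw [this]; exact stepFun_floorDet _ _ _ _
    · push Not at hσz
      exfalso
      have h1 := stepFun_eq_add_intInd hincN hDne hs0 hs (hlev N hN n) hσ hσz
      exact absurd (jumpSum_le_of_intInd hs0 (measurableSet_of_intInd_eq hσ) h1) (not_le.2 hlarge)
  -- At most three jumps `±1` with sum zero: there are exactly two, of opposite signs.
  · have hpm : ∀ i ∈ D, s i = 1 ∨ s i = -1 := fun i hi => (abs_eq zero_le_one).1 (hs i hi)
    obtain ⟨i, hi, j, hj, hij, hD, hsi, hsj⟩ : ∃ i ∈ D, ∃ j ∈ D, i ≠ j ∧ D = {i, j} ∧ s i = 1 ∧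
        s j = -1 := by
      have hpos := hDne.card_pos
      have h3 : D.card = 1 ∨ D.card = 2 ∨ D.card = 3 := by omega
      rcases h3 with h | h | h
      · obtain ⟨a, rfl⟩ := Finset.card_eq_one.1 h
        have := hpm a (by simp)
        simp only [Finset.sum_singleton] at hs0
        omega
      · obtain ⟨a, b, hab, rfl⟩ := Finset.card_eq_two.1 h
        have ha := hpm a (by simp)
        have hb := hpm b (by simp)
        rw [Finset.sum_pair hab] at hs0
        rcases ha with ha | ha
        · exact ⟨a, by simp, b, by simp, hab, rfl, ha, by omega⟩
        · exact ⟨b, by simp, a, by simp, hab.symm, Finset.pair_comm a b, by omega, ha⟩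
      · obtain ⟨a, b, e, hab, hae, hbe, rfl⟩ := Finset.card_eq_three.1 h
        have ha := hpm a (by simp)
        have hb := hpm b (by simp)
        have he := hpm e (by simp)
        rw [Finset.sum_insert (by simp [hab, hae]), Finset.sum_pair hbe] at hs0
        omega
    -- The orientation matters: the arc runs from the upward jump at `p i` to the downward jump at
    -- `p j`, so the fractional part of `N (p j - p i)` is its length.
    obtain ⟨N, hN, h1, h2⟩ := exists_nat_mul_fract_le (hrat j hj i hi hij.symm)
    rw [mul_sub] at h1 h2
    refine exists_restrBij_fold hmeas hN fun n _ => ?_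
    obtain ⟨Λ, hΛ⟩ := exists_restrBij_two_nodes h1 h2 (N * c) n
    refine ⟨Λ, hΛ.congr (Eventually.of_forall fun t => ?_)⟩
    rw [hlev N hN, hD, stepFun, Finset.sum_pair hij, hsi, hsj]
    have e : N * c + (1 * ⌊t - N * p i⌋ + -1 * ⌊t - N * p j⌋) =
      N * c + (⌊t - N * p i⌋ - ⌊t - N * p j⌋) := by ring
    rw [e]; exact Iff.rfl

/-! ### Finite unions of intervals -/

theorem floor_sub_eq_floor_iff {t a : ℝ} (h0 : 0 ≤ a) : ⌊t - a⌋ = ⌊t⌋ ↔ a ≤ Int.fract t := by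
  have h2 := Int.fract_nonneg t
  have h3 := Int.fract_lt_one t
  have h4 := Int.self_sub_floor t
  rw [Int.floor_eq_iff]
  constructor
  · intro h; linarith [h.1]
  · intro h; constructor <;> linarith

theorem exists_nodes (X : Finset ℝ) : ∃ (D : Finset ℕ) (p : ℕ → ℝ), ∀ x ∈ X, ∃ i ∈ D, p i = x := by
  refine ⟨Finset.range X.card,
    fun n => if h : n < X.card then (X.equivFin.symm ⟨n, h⟩ : ℝ) else 0, fun x hx => ?_⟩
  refine ⟨X.equivFin ⟨x, hx⟩, Finset.mem_range.2 (Fin.is_lt _), ?_⟩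
  simp

theorem exists_endpoints {I : Set ℝ} (hI : I.OrdConnected) (h01 : I ⊆ Set.Icc 0 1) :
    ∃ a ∈ Set.Icc (0 : ℝ) 1, ∃ b ∈ Set.Icc (0 : ℝ) 1, ∀ t, t ≠ a → t ≠ b →
      (t ∈ I ↔ a ≤ t ∧ t < b) := by
  rcases I.eq_empty_or_nonempty with rfl | hne
  · exact ⟨0, by simp, 0, by simp, fun t _ _ => ⟨fun h => absurd h (Set.notMem_empty t),
      fun h => absurd h.2 (not_lt.2 h.1)⟩⟩
  · have hb : BddBelow I := ⟨0, fun x hx => (h01 hx).1⟩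
    have ha : BddAbove I := ⟨1, fun x hx => (h01 hx).2⟩
    obtain ⟨x, hx⟩ := hne
    refine ⟨sInf I, ⟨le_csInf ⟨x, hx⟩ fun y hy => (h01 hy).1, (csInf_le hb hx).trans (h01 hx).2⟩,
      sSup I, ⟨(h01 hx).1.trans (le_csSup ha hx), csSup_le ⟨x, hx⟩ fun y hy => (h01 hy).2⟩,
      fun t hta htb => ⟨fun h => ⟨csInf_le hb h, lt_of_le_of_ne (le_csSup ha h) htb⟩, fun h => ?_⟩⟩
    obtain ⟨y, hy, hyt⟩ := exists_lt_of_csInf_lt ⟨x, hx⟩ (lt_of_le_of_ne h.1 hta.symm)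
    obtain ⟨z, hz, htz⟩ := exists_lt_of_lt_csSup ⟨x, hx⟩ h.2
    exact hI.out hy hz ⟨hyt.le, htz.le⟩

/-- A finite union of intervals in `[0, 1]` agrees almost everywhere with a periodic set with
finitely many jumps. -/
theorem exists_periodic_model {L : ℕ} {I : Fin L → Set ℝ} (hI : ∀ i, (I i).OrdConnected)
    (h01 : ⋃ i, I i ⊆ Set.Icc 0 1) : ∃ (E : Set ℝ) (D : Finset ℕ) (p : ℕ → ℝ),
      (∀ t, t + 1 ∈ E ↔ t ∈ E) ∧ FloorDet D p (· ∈ E) ∧ ∀ᵐ t ∂unitVol, (t ∈ ⋃ i, I i ↔ t ∈ E) := by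
  classical
  choose a ha b hb hab using fun i => exists_endpoints (hI i) ((Set.subset_iUnion I i).trans h01)
  -- The node `0` fixes `⌊t⌋`, against which the floors at the endpoints are compared.
  obtain ⟨D, p, hp⟩ := exists_nodes ({0} ∪ (Finset.univ.image a ∪ Finset.univ.image b))
  refine ⟨{t | ∃ i, a i ≤ Int.fract t ∧ Int.fract t < b i}, D, p, fun t => ?_, ?_, ?_⟩
  · change (∃ i, a i ≤ Int.fract (t + 1) ∧ Int.fract (t + 1) < b i) ↔
      ∃ i, a i ≤ Int.fract t ∧ Int.fract t < b i
    rw [Int.fract_add_one]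
  · intro t t' h
    have hx : ∀ x ∈ ({0} ∪ (Finset.univ.image a ∪ Finset.univ.image b) : Finset ℝ),
        ⌊t - x⌋ = ⌊t' - x⌋ := by
      intro x hx
      obtain ⟨i, hi, rfl⟩ := hp x hx
      exact h i hi
    have h0 : ⌊t⌋ = ⌊t'⌋ := by simpa using hx 0 (by simp)
    refine propext (exists_congr fun i => ?_)
    rw [← not_le, ← not_le, ← floor_sub_eq_floor_iff (ha i).1,
      ← floor_sub_eq_floor_iff (hb i).1, ← floor_sub_eq_floor_iff (ha i).1,
      ← floor_sub_eq_floor_iff (hb i).1, hx (a i) (by simp), hx (b i) (by simp), h0]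
  · have h1 : ∀ᵐ t ∂unitVol, ∀ i, t ≠ a i ∧ t ≠ b i := by
      rw [ae_all_iff]; intro i
      exact ae_restrict_of_ae ((Measure.ae_ne volume (a i)).and (Measure.ae_ne volume (b i)))
    filter_upwards [h1, ae_lt_one, ae_restrict_mem measurableSet_Ioc] with t h1 h2 h3
    rw [Set.mem_iUnion]
    refine exists_congr fun i => ?_
    rw [hab i t (h1 i).1 (h1 i).2, Int.fract_eq_self.2 ⟨h3.1.le, h2⟩]

/-- The floor of `(z + j) / N` depends on `z` only through `⌊z⌋`. -/
theorem floorDet_foldLevel {D : Finset ℕ} {p : ℕ → ℝ} {E : Set ℝ} (h : FloorDet D p (· ∈ E)) {N : ℕ}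
    (hN : 0 < N) (n : ℕ) : FloorDet D (fun i => N * p i) (· ∈ foldLevel N E n) := by
  have hN' : (N : ℝ) ≠ 0 := by exact_mod_cast hN.ne'
  intro y y' hy
  have h1 : foldIdx N E y = foldIdx N E y' := by
    ext j
    rw [mem_foldIdx, mem_foldIdx]
    refine and_congr_right fun _ => iff_of_eq (h _ _ fun i hi => ?_)
    have e : ∀ y : ℝ, (y + j) / N - p i = (y - N * p i + j) / N := fun y => by field_simp; ring
    rw [e, e, Int.floor_div_natCast, Int.floor_div_natCast, Int.floor_add_natCast,
      Int.floor_add_natCast, hy i hi]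
  refine propext ?_
  change y ∈ foldLevel N E n ↔ y' ∈ foldLevel N E n
  rw [mem_foldLevel, mem_foldLevel, h1]

/-- Moving `y` by one shifts the fibre cyclically: the point that leaves is congruent modulo one to
the point that enters. -/
theorem foldLevel_add_one {E : Set ℝ} (hE : ∀ t, t + 1 ∈ E ↔ t ∈ E) {N : ℕ} (hN : 0 < N) (n : ℕ)
    (y : ℝ) : y + 1 ∈ foldLevel N E n ↔ y ∈ foldLevel N E n := by
  have hN' : (N : ℝ) ≠ 0 := by exact_mod_cast hN.ne'
  have h1 : ((foldIdx N E (y + 1)).card : ℤ) = (foldIdx N E y).card := by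
    rw [card_foldIdx, card_foldIdx]
    have h2 := Finset.sum_range_succ (fun j : ℕ => intInd E ((y + j) / N)) N
    have h3 := Finset.sum_range_succ' (fun j : ℕ => intInd E ((y + j) / N)) N
    have h4 : (y + (N : ℝ)) / N = (y + (0 : ℕ)) / N + 1 := by field_simp; push_cast; ring
    rw [h4, intInd_periodic hE] at h2
    have h5 : ∑ j ∈ Finset.range N, intInd E ((y + 1 + j) / N) =
        ∑ j ∈ Finset.range N, intInd E ((y + (j + 1 : ℕ)) / N) :=
      Finset.sum_congr rfl fun j _ => by congr 2; push_cast; ring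
    rw [h5]; linarith
  rw [mem_foldLevel, mem_foldLevel]
  have : (foldIdx N E (y + 1)).card = (foldIdx N E y).card := by exact_mod_cast h1
  rw [this]

/-- The number of sheets over two points differs by at most the number of intervals. -/
theorem card_foldIdx_le_add {L N : ℕ} {I : Fin L → Set ℝ} (hI : ∀ i, (I i).OrdConnected) {y y' : ℝ}
    (hy : y ∈ Set.Ioc (0 : ℝ) 1) (hy' : y' ∈ Set.Ioc (0 : ℝ) 1) :
    (foldIdx N (⋃ i, I i) y).card ≤ (foldIdx N (⋃ i, I i) y').card + L := by
  classical
  have h1 : (foldIdx N (⋃ i, I i) y \ foldIdx N (⋃ i, I i) y').card ≤ L := by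
    have hex : ∀ j ∈ foldIdx N (⋃ i, I i) y \ foldIdx N (⋃ i, I i) y', ∃ i, (y + j) / N ∈ I i :=
      fun j hj => Set.mem_iUnion.1 (mem_foldIdx.1 (Finset.mem_sdiff.1 hj).1).2
    rcases Nat.eq_zero_or_pos L with rfl | hL
    · rw [Finset.card_eq_zero.2 (Finset.eq_empty_of_forall_notMem fun j hj =>
        (hex j hj).elim fun i _ => i.elim0)]
    have : Nonempty (Fin L) := ⟨⟨0, hL⟩⟩
    choose! i hi using hex
    -- Each index lost on passing from `y` to `y'` is assigned an interval that contains its point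
    -- over `y`. Two lost indices `j < l` cannot share one: as `y` and `y'` differ by less than one,
    -- `(y' + j) / N` or `(y' + l) / N` lies between their points, hence in the interval.
    have hlt : ∀ j ∈ foldIdx N (⋃ i, I i) y \ foldIdx N (⋃ i, I i) y',
        ∀ l ∈ foldIdx N (⋃ i, I i) y \ foldIdx N (⋃ i, I i) y', i j = i l → ¬ j < l := by
      intro j hj l hl hjl hlt
      have hN : (0 : ℝ) < N := by
        exact_mod_cast (Nat.zero_le j).trans_lt (mem_foldIdx.1 (Finset.mem_sdiff.1 hj).1).1
      have h2 : (j : ℝ) + 1 ≤ l := by exact_mod_cast hlt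
      have hj2 := hi j hj
      have hl2 := hi l hl
      rw [← hjl] at hl2
      have hnot : ∀ k ∈ foldIdx N (⋃ i, I i) y \ foldIdx N (⋃ i, I i) y', (y' + k) / N ∉ I (i j) :=
        fun k hk hmem => (Finset.mem_sdiff.1 hk).2 (mem_foldIdx.2
          ⟨(mem_foldIdx.1 (Finset.mem_sdiff.1 hk).1).1, Set.mem_iUnion.2 ⟨_, hmem⟩⟩)
      rcases le_total y y' with h | h
      · refine hnot j hj ((hI _).out hj2 hl2 ⟨?_, ?_⟩)
        · gcongr
        · rw [div_le_div_iff_of_pos_right hN]; linarith [hy.1, hy'.2]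
      · refine hnot l hl ((hI _).out hj2 hl2 ⟨?_, ?_⟩)
        · rw [div_le_div_iff_of_pos_right hN]; linarith [hy.2, hy'.1]
        · gcongr
    calc _ ≤ (Finset.univ : Finset (Fin L)).card := by
          refine Finset.card_le_card_of_injOn i (fun _ _ => Finset.mem_univ _) ?_
          intro j hj l hl hjl
          rcases lt_trichotomy j l with h | h | h
          · exact absurd h (hlt j hj l hl hjl)
          · exact h
          · exact absurd h (hlt l hl j hj hjl.symm)
      _ = L := by simp
  have h2 := Finset.card_le_card_sdiff_add_card (s := foldIdx N (⋃ i, I i) y)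
    (t := foldIdx N (⋃ i, I i) y')
  omega

theorem integral_card_foldIdx {S : Set ℝ} (hS : MeasurableSet S) {N : ℕ} (hN : 0 < N) :
    Integrable (fun y => ((foldIdx N S y).card : ℝ)) unitVol ∧
      ∫ y, ((foldIdx N S y).card : ℝ) ∂unitVol = N * unitVol.real S := by
  classical
  have hN' : (N : ℂ) ≠ 0 := by exact_mod_cast hN.ne'
  have hcard : ∀ y, ((foldIdx N S y).card : ℂ) =
      ∑ j ∈ Finset.range N, S.indicator (1 : ℝ → ℂ) ((y + j) / N) := by
    intro y
    have := card_foldIdx (N := N) S y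
    have h2 : ((foldIdx N S y).card : ℂ) = (((foldIdx N S y).card : ℤ) : ℂ) := by push_cast; rfl
    rw [h2, this]; push_cast
    exact Finset.sum_congr rfl fun j _ => by simp [intInd, Set.indicator_apply]
  have hm : MemLp (S.indicator (1 : ℝ → ℂ)) 2 unitVol := (memLp_const (1 : ℂ)).indicator hS
  have hj : ∀ j ∈ Finset.range N,
      Integrable (fun y : ℝ => S.indicator (1 : ℝ → ℂ) ((y + j) / N)) unitVol :=
    fun j hj => (hm.comp_foldPt (Finset.mem_range.1 hj)).integrable (by norm_num)
  have hint : Integrable (fun y => ((foldIdx N S y).card : ℂ)) unitVol := by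
    simp_rw [hcard]; exact integrable_finsetSum _ hj
  have h1 : ∫ y, ((foldIdx N S y).card : ℂ) ∂unitVol = N * (unitVol.real S : ℂ) := by
    have h2 : ∫ t, S.indicator (1 : ℝ → ℂ) t ∂unitVol = (unitVol.real S : ℂ) := by
      rw [integral_indicator hS]; simp [Measure.real]
    rw [← h2, integral_unitVol_foldPt hN (hm.integrable (by norm_num)), ← Finset.mul_sum,
      ← mul_assoc, mul_inv_cancel₀ hN', one_mul]
    simp_rw [hcard]
    exact integral_finsetSum _ hj
  refine ⟨by simpa using hint.re, ?_⟩
  have h3 : ∫ y, (((foldIdx N S y).card : ℝ) : ℂ) ∂unitVol = ((N * unitVol.real S : ℝ) : ℂ) := by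
    push_cast; exact h1
  rw [integral_complex_ofReal] at h3
  exact_mod_cast h3

theorem restrict_eq_unitVol_restrict {S : Set ℝ} (hS : S ⊆ Set.Icc 0 1) (hm : MeasurableSet S) :
    volume.restrict S = unitVol.restrict S := by
  rw [Measure.restrict_restrict hm]
  apply Measure.restrict_congr_set
  filter_upwards [Measure.ae_ne volume (0 : ℝ)] with t ht
  exact propext ⟨fun h => ⟨h, lt_of_le_of_ne (hS h).1 ht.symm, (hS h).2⟩, fun h => h.1⟩

/-- The number of sheets over every point is within the number of intervals of `N |S|`. -/
theorem card_foldIdx_bounds {L N m : ℕ} (hN : 0 < N) {I : Fin L → Set ℝ}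
    (hI : ∀ i, (I i).OrdConnected) (hS : MeasurableSet (⋃ i, I i))
    (hm₁ : (m : ℝ) ≤ N * unitVol.real (⋃ i, I i)) (hm₂ : N * unitVol.real (⋃ i, I i) < (m : ℝ) + 1)
    {y : ℝ} (hy : y ∈ Set.Ioc (0 : ℝ) 1) :
    m ≤ (foldIdx N (⋃ i, I i) y).card + L ∧ (foldIdx N (⋃ i, I i) y).card ≤ m + L := by
  obtain ⟨hint, hval⟩ := integral_card_foldIdx hS hN
  constructor
  -- The count is an integer with mean at least `m`, so somewhere it is at least `m`; symmetrically,
  -- a mean below `m + 1` gives a point with count at most `m`.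
  · obtain ⟨z, hz, hzm⟩ : ∃ z ∈ Set.Ioc (0 : ℝ) 1, m ≤ (foldIdx N (⋃ i, I i) z).card := by
      by_contra! hcon
      have h1 : ∫ y, ((foldIdx N (⋃ i, I i) y).card : ℝ) ∂unitVol ≤ ∫ _, ((m : ℝ) - 1) ∂unitVol := by
        refine integral_mono_ae hint (integrable_const _) ?_
        filter_upwards [ae_restrict_mem measurableSet_Ioc] with t ht
        have : ((foldIdx N (⋃ i, I i) t).card : ℝ) + 1 ≤ m := by exact_mod_cast hcon t ht
        linarith
      rw [integral_const, hval] at h1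
      simp only [probReal_univ, one_smul] at h1
      linarith
    exact hzm.trans (card_foldIdx_le_add hI hz hy)
  · obtain ⟨z, hz, hzm⟩ : ∃ z ∈ Set.Ioc (0 : ℝ) 1, (foldIdx N (⋃ i, I i) z).card ≤ m := by
      by_contra! hcon
      have h1 : ∫ _, ((m : ℝ) + 1) ∂unitVol ≤ ∫ y, ((foldIdx N (⋃ i, I i) y).card : ℝ) ∂unitVol := by
        refine integral_mono_ae (integrable_const _) hint ?_
        filter_upwards [ae_restrict_mem measurableSet_Ioc] with t ht
        exact_mod_cast hcon t ht
      rw [integral_const, hval] at h1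
      simp only [probReal_univ, one_smul] at h1
      linarith
    exact (card_foldIdx_le_add hI hy hz).trans (Nat.add_le_add_right hzm L)

/-- In the two extreme ranges the set of frequencies has to be exactly `ℤ` or `∅`, since the final
inclusions rest on it; only the levels in between need the existence theorem. -/
theorem exists_restrBij_foldLevel {L N m : ℕ} (hN : 0 < N) {I : Fin L → Set ℝ}
    (hI : ∀ i, (I i).OrdConnected) (h01 : ⋃ i, I i ⊆ Set.Icc 0 1) (hS : MeasurableSet (⋃ i, I i))
    (hm₁ : (m : ℝ) ≤ N * unitVol.real (⋃ i, I i)) (hm₂ : N * unitVol.real (⋃ i, I i) < (m : ℝ) + 1)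
    (n : ℕ) : ∃ Λ, RestrBij (foldLevel N (⋃ i, I i) n) Λ ∧ (n + L < m → Λ = Set.univ) ∧
      (m + L ≤ n → Λ = ∅) := by
  have hb := fun {y} (hy : y ∈ Set.Ioc (0 : ℝ) 1) => card_foldIdx_bounds hN hI hS hm₁ hm₂ hy
  by_cases h1 : n + L < m
  · refine ⟨Set.univ, restrBij_univ ?_, fun _ => rfl, fun h => by omega⟩
    filter_upwards [ae_restrict_mem measurableSet_Ioc] with y hy
    rw [mem_foldLevel]; have := hb hy; omega
  by_cases h2 : m + L ≤ n
  · refine ⟨∅, restrBij_empty ?_, fun h => absurd h h1, fun _ => rfl⟩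
    filter_upwards [ae_restrict_mem measurableSet_Ioc] with y hy
    rw [mem_foldLevel]; have := hb hy; omega
  obtain ⟨E, D, p, hE, hdet, hae⟩ := exists_periodic_model hI h01
  obtain ⟨Λ, hΛ⟩ := exists_restrBij_of_floorDet _ D _ _ rfl (foldLevel_add_one hE hN n)
    (floorDet_foldLevel hdet hN n)
  refine ⟨Λ, hΛ.congr ?_, fun h => absurd h h1, fun h => absurd h h2⟩
  filter_upwards [ae_foldPt (N := N) hae] with y hy
  have : foldIdx N E y = foldIdx N (⋃ i, I i) y := by
    ext j
    rw [mem_foldIdx, mem_foldIdx]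
    exact and_congr_right fun hj => (hy j hj).symm
  rw [mem_foldLevel, mem_foldLevel, this]

theorem mainTheorem6 (L N m : ℕ) (hN : 0 < N) (S : Set ℝ) (I : Fin L → Set ℝ)
    (hI : ∀ i, (I i).OrdConnected) (hSI : S = ⋃ i, I i) (hS : S ⊆ Set.Icc 0 1)
    (hm₁ : (m : ℝ) / N ≤ volume.real S) (hm₂ : volume.real S < ((m : ℝ) + 1) / N) :
    ∃ Λ : Set ℝ, Λ ⊆ Set.range (Int.cast : ℤ → ℝ) ∧ IsExpRieszBasis S Λ ∧
      (⋃ j ∈ Set.Icc (0 : ℤ) ((m : ℤ) - 2 * L - 1), progression N j) ⊆ Λ ∧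
      Λ ⊆ ⋃ j ∈ Set.Icc (0 : ℤ) ((m : ℤ) + 2 * L), progression N j := by
  have hNp : (0 : ℝ) < N := by exact_mod_cast hN
  have hmeas : MeasurableSet S := by
    rw [hSI]; exact MeasurableSet.iUnion fun i => (hI i).measurableSet
  have hvol : volume.real S = unitVol.real S := by
    have h1 := congrArg (fun μ : Measure ℝ => μ.real S) (restrict_eq_unitVol_restrict hS hmeas)
    simpa [Measure.real, Measure.restrict_apply_self] using h1
  rw [hvol, div_le_iff₀' hNp] at hm₁
  rw [hvol, lt_div_iff₀' hNp] at hm₂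
  -- This keeps the residues of the left-hand union below `N`, where the folding sees them.
  have hmN : m ≤ N := by
    have h1 : unitVol.real S ≤ 1 := measureReal_le_one
    have h2 : (m : ℝ) ≤ N := hm₁.trans (by nlinarith)
    exact_mod_cast h2
  subst hSI
  choose Λ hΛ hfull hempty using exists_restrBij_foldLevel hN hI hS hmeas hm₁ hm₂
  refine ⟨(fun k : ℤ => (k : ℝ)) '' {k | ∃ n < N, ∃ l ∈ Λ n, k = N * l + n}, ?_, ?_, ?_, ?_⟩
  · rintro _ ⟨k, -, rfl⟩; exact ⟨k, rfl⟩
  · exact (RestrBij.fold hmeas hN fun n _ => hΛ n).isExpRieszBasis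
      (restrict_eq_unitVol_restrict hS hmeas) hmeas
  · intro x hx
    simp only [Set.mem_iUnion] at hx
    obtain ⟨j, ⟨hj0, hj1⟩, k, rfl⟩ := hx
    obtain ⟨n, rfl⟩ := Int.eq_ofNat_of_zero_le hj0
    refine ⟨N * k + n, ⟨n, by omega, k, ?_, rfl⟩, by push_cast; rfl⟩
    rw [hfull n (by omega)]; trivial
  · rintro _ ⟨_, ⟨n, -, l, hl, rfl⟩, rfl⟩
    simp only [Set.mem_iUnion]
    have hn : n < m + L := by
      by_contra h
      rw [hempty n (not_lt.1 h)] at hl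
      exact hl
    exact ⟨n, ⟨by omega, by omega⟩, l, by push_cast; rfl⟩
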